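/- Let $d \in \mathbf N$ and let $s,t>0$ satisfy $s+t>1$. For $h>0$ and $f \in C^\infty(\mathbf R^d)$ put $\|f\|_h = \sup \frac{|x^\alpha \partial^\beta f(x)|}{h^{|\alpha+\beta|}\,\alpha!^t\,\beta!^s}$, with supremum over $x \in \mathbf R^d$ and $\alpha,\beta \in \mathbf N^d$. Let $\Sigma_t^s(\mathbf R^d)$ be the space of all $f \in C^\infty(\mathbf R^d)$ with $\|f\|_h<\infty$ for every $h>0$, with the topology defined by the seminorms $\|\cdot\|_h$, $h>0$. Let $(\Sigma_t^s)'(\mathbf R^d)$ be its topological dual. The action of $u \in (\Sigma_t^s)'(\mathbf R^d)$ on $\varphi \in \Sigma_t^s(\mathbf R^d)$ is written $(u,\varphi)$ and is taken conjugate linear in $\varphi$, consistently with $(f,\varphi) = \int f \overline{\varphi}\,dx$ for functions. Fix a window $\psi \in \Sigma_t^s(\mathbf R^d)\setminus 0$ and define, for $u \in (\Sigma_t^s)'(\mathbf R^d)$, $$V_\psi u(x,\xi) = (2\pi)^{-d/2}\,(u, M_\xi T_x \psi), \qquad M_\xi T_x\psi(y) = e^{i\langle y,\xi\rangle}\psi(y-x),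 \qquad x,\xi \in \mathbf R^d.$$ The $t,s$-Gelfand--Shilov wave front set $\mathrm{WF}^{t,s}(u) \subseteq (\mathbf R^d\times\mathbf R^d) \setminus 0$ is defined as follows: a point $(x_0,\xi_0) \neq 0$ satisfies $(x_0,\xi_0) \notin \mathrm{WF}^{t,s}(u)$ if and only if there is an open set $U \subseteq (\mathbf R^d\times \mathbf R^d)\setminus 0$ containing $(x_0,\xi_0)$ such that $$\sup_{\lambda>0,\ (x,\xi)\in U} e^{r\lambda}\,|V_\psi u(\lambda^t x,\lambda^s \xi)| < \infty \qquad \text{for all } r>0.$$ Proposition. Let $u \in (\Sigma_t^s)'(\mathbf R^d)$. If $$\mathrm{WF}^{t,s}(u) \cap \big(\{0\}\times(\mathbf R^d\setminus 0)\big) = \emptyset,$$ then $u \in C^\infty(\mathbf R^d)$, that is, there is a function $f \in C^\infty(\mathbf R^d)$ such that $(u,\varphi) = \int_{\mathbf R^d} f(x)\,\overline{\varphi(x)}\,dx$, with absolutely convergent integral, for all $\varphi \in \Sigma_t^s(\mathbf R^d)$; and, with $u$ identified with $f$, there exist $C,r>0$ such that $$|\partial^\alpha u(x)| \leqslant C^{1+|\alpha|}\,\alpha!^s\,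 e^{r|x|^{1/t}}, \qquad x \in \mathbf R^d,\ \alpha \in \mathbf N^d.$$ -/

import Mathlib

open scoped ContDiff

noncomputable section

namespace GS

/-- Euclidean space `ℝ^d` with the Euclidean norm. Phase space `T^*ℝ^d` is `Rd d × Rd d`. -/
abbrev Rd (d : ℕ) : Type := EuclideanSpace ℝ (Fin d)

variable {d : ℕ}

/-! ### Multi-index notation -/

/-- The length `|α| = α₁ + ⋯ + α_d`. -/
def mlen (α : Fin d → ℕ) : ℕ := ∑ i, α i

/-- The factorial `α! = α₁! ⋯ α_d!`. -/
def mfact (α : Fin d → ℕ) : ℕ := ∏ i, (α i).factorial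

/-- The monomial `x^α = x₁^α₁ ⋯ x_d^α_d`. -/
def monom (α : Fin d → ℕ) (x : Rd d) : ℝ := ∏ i, x i ^ α i

/-- The partial derivative `∂_i f`. -/
def pd (i : Fin d) (f : Rd d → ℂ) : Rd d → ℂ :=
  fun x => fderiv ℝ f x (EuclideanSpace.single i (1 : ℝ))

/-- The composition of the `∂_i^{β_i}` over the indices `i` in a list. -/
def pdList (l : List (Fin d)) (β : Fin d → ℕ) (f : Rd d → ℂ) : Rd d → ℂ :=
  l.foldr (fun i g => (pd i)^[β i] g) f

/-- The partial derivative `∂^β f = ∂₁^β₁ ⋯ ∂_d^β_d f`. -/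
def pderiv (β : Fin d → ℕ) (f : Rd d → ℂ) : Rd d → ℂ :=
  pdList (List.finRange d) β f

/-! ### Elementary facts on partial derivatives of smooth functions -/

lemma contDiff_pd {f : Rd d → ℂ} (hf : ContDiff ℝ ∞ f) (i : Fin d) : ContDiff ℝ ∞ (pd i f) :=
  (hf.fderiv_right (m := ∞) (by simp)).clm_apply contDiff_const

lemma contDiff_pd_iterate {f : Rd d → ℂ} (hf : ContDiff ℝ ∞ f) (i : Fin d) (n : ℕ) :
    ContDiff ℝ ∞ ((pd i)^[n] f) := by
  induction n with
  | zero => exact hf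
  | succ n ih => rw [Function.iterate_succ_apply']; exact contDiff_pd ih i

lemma contDiff_pdList {f : Rd d → ℂ} (hf : ContDiff ℝ ∞ f) (l : List (Fin d)) (β : Fin d → ℕ) :
    ContDiff ℝ ∞ (pdList l β f) := by
  induction l with
  | nil => exact hf
  | cons i l ih => exact contDiff_pd_iterate ih i _

lemma pd_add {f g : Rd d → ℂ} (hf : ContDiff ℝ ∞ f) (hg : ContDiff ℝ ∞ g) (i : Fin d) :
    pd i (f + g) = pd i f + pd i g := by
  funext x
  simp [pd, fderiv_add (hf.differentiable (by simp) x) (hg.differentiable (by simp) x)]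

lemma pd_smul {f : Rd d → ℂ} (c : ℂ) (hf : ContDiff ℝ ∞ f) (i : Fin d) :
    pd i (c • f) = c • pd i f := by
  funext x
  simp [pd, fderiv_const_smul (hf.differentiable (by simp) x)]

lemma pd_iterate_add {f g : Rd d → ℂ} (hf : ContDiff ℝ ∞ f) (hg : ContDiff ℝ ∞ g) (i : Fin d)
    (n : ℕ) : (pd i)^[n] (f + g) = (pd i)^[n] f + (pd i)^[n] g := by
  induction n with
  | zero => rfl
  | succ n ih =>
    simp only [Function.iterate_succ_apply', ih]
    exact pd_add (contDiff_pd_iterate hf i n) (contDiff_pd_iterate hg i n) i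

lemma pd_iterate_smul {f : Rd d → ℂ} (c : ℂ) (hf : ContDiff ℝ ∞ f) (i : Fin d)
    (n : ℕ) : (pd i)^[n] (c • f) = c • (pd i)^[n] f := by
  induction n with
  | zero => rfl
  | succ n ih =>
    simp only [Function.iterate_succ_apply', ih]
    exact pd_smul c (contDiff_pd_iterate hf i n) i

lemma pderiv_add {f g : Rd d → ℂ} (hf : ContDiff ℝ ∞ f) (hg : ContDiff ℝ ∞ g) (β : Fin d → ℕ) :
    pderiv β (f + g) = pderiv β f + pderiv β g := by
  unfold pderiv
  induction List.finRange d with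
  | nil => rfl
  | cons i l ih =>
    simp only [pdList, List.foldr_cons] at ih ⊢
    rw [ih]
    exact pd_iterate_add (contDiff_pdList hf l β) (contDiff_pdList hg l β) i _

lemma pderiv_smul {f : Rd d → ℂ} (c : ℂ) (hf : ContDiff ℝ ∞ f) (β : Fin d → ℕ) :
    pderiv β (c • f) = c • pderiv β f := by
  unfold pderiv
  induction List.finRange d with
  | nil => rfl
  | cons i l ih =>
    simp only [pdList, List.foldr_cons] at ih ⊢
    rw [ih]
    exact pd_iterate_smul c (contDiff_pdList hf l β) i _

lemma pd_comm {f : Rd d → ℂ} (hf : ContDiff ℝ ∞ f) (i j : Fin d) :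
    pd i (pd j f) = pd j (pd i f) := by
  have hd : Differentiable ℝ (fderiv ℝ f) :=
    (hf.fderiv_right (m := ∞) (by simp)).differentiable (by simp)
  have key : ∀ (i j : Fin d) (x : Rd d), pd i (pd j f) x =
      fderiv ℝ (fderiv ℝ f) x (EuclideanSpace.single i (1 : ℝ))
        (EuclideanSpace.single j (1 : ℝ)) := by
    intro i j x
    have h := (hd x).hasFDerivAt.clm_apply
      (hasFDerivAt_const (EuclideanSpace.single j (1 : ℝ)) x)
    have h2 : fderiv ℝ (pd j f) x = _ := h.fderiv
    simp [pd] at h2 ⊢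
    rw [h2]
    simp
  funext x
  rw [key i j, key j i]
  have h2 : (2 : WithTop ℕ∞) ≤ ∞ := WithTop.coe_le_coe.2 (le_top : (2 : ℕ∞) ≤ ⊤)
  exact (hf.contDiffAt.isSymmSndFDerivAt (by simpa using h2)) _ _

lemma pd_iterate_comm {f : Rd d → ℂ} (hf : ContDiff ℝ ∞ f) (i j : Fin d) (m n : ℕ) :
    (pd i)^[m] ((pd j)^[n] f) = (pd j)^[n] ((pd i)^[m] f) := by
  have h1 : ∀ (n : ℕ) (g : Rd d → ℂ), ContDiff ℝ ∞ g →
      pd i ((pd j)^[n] g) = (pd j)^[n] (pd i g) := by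
    intro n
    induction n with
    | zero => intro g _; rfl
    | succ n ih =>
      intro g hg
      rw [Function.iterate_succ_apply, Function.iterate_succ_apply, ih _ (contDiff_pd hg j),
        pd_comm hg]
  induction m with
  | zero => rfl
  | succ m ih =>
    rw [Function.iterate_succ_apply', Function.iterate_succ_apply', ih,
      h1 n _ (contDiff_pd_iterate hf i m)]

lemma pdList_update_of_notMem (j : Fin d) (k : ℕ) (β : Fin d → ℕ) (f : Rd d → ℂ)
    (l : List (Fin d)) (hl : j ∉ l) : pdList l (Function.update β j k) f = pdList l β f := by
  induction l with
  | nil => rfl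
  | cons i l ih =>
    simp only [List.mem_cons, not_or] at hl
    have := ih hl.2
    simp only [pdList, List.foldr_cons] at this ⊢
    rw [this, Function.update_of_ne (Ne.symm hl.1)]

lemma pdList_split (j : Fin d) (β : Fin d → ℕ) {f : Rd d → ℂ} (hf : ContDiff ℝ ∞ f)
    (l : List (Fin d)) (hl : l.Nodup) (hj : j ∈ l) :
    pdList l β f = (pd j)^[β j] (pdList l (Function.update β j 0) f) := by
  induction l with
  | nil => simp at hj
  | cons i l ih =>
    rw [List.nodup_cons] at hl
    by_cases hij : i = j
    · subst hij
      have := pdList_update_of_notMem i 0 β f l hl.1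
      simp only [pdList, List.foldr_cons, Function.update_self] at this ⊢
      rw [this]
      rfl
    · have hj' : j ∈ l := by
        rcases List.mem_cons.1 hj with h | h
        · exact absurd h.symm hij
        · exact h
      have := ih hl.2 hj'
      have hc := contDiff_pdList hf l (Function.update β j 0)
      simp only [pdList, List.foldr_cons] at this hc ⊢
      rw [this, Function.update_of_ne hij, pd_iterate_comm hc]

lemma pderiv_split (j : Fin d) (β : Fin d → ℕ) {f : Rd d → ℂ} (hf : ContDiff ℝ ∞ f) :
    pderiv β f = (pd j)^[β j] (pderiv (Function.update β j 0) f) :=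
  pdList_split j β hf _ (List.nodup_finRange d) (List.mem_finRange j)

lemma contDiff_pderiv {f : Rd d → ℂ} (hf : ContDiff ℝ ∞ f) (β : Fin d → ℕ) :
    ContDiff ℝ ∞ (pderiv β f) := contDiff_pdList hf _ β

/-! ### The space `Σ_t^s(ℝ^d)` -/

/-- The quotient `|x^α ∂^β f(x)| / (h^{|α+β|} α!^t β!^s)`. -/
def gsQuot (t s h : ℝ) (f : Rd d → ℂ) (p : (Fin d → ℕ) × (Fin d → ℕ) × Rd d) : ℝ :=
  |monom p.1 p.2.2| * ‖pderiv p.2.1 f p.2.2‖ /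
    (h ^ (mlen p.1 + mlen p.2.1) * (mfact p.1 : ℝ) ^ t * (mfact p.2.1 : ℝ) ^ s)

/-- `f ∈ Σ_t^s(ℝ^d)`: `f` is smooth and, for every `h > 0`, the supremum of
`|x^α ∂^β f(x)| / (h^{|α+β|} α!^t β!^s)` over all `α, β, x` is finite. -/
def IsGS (t s : ℝ) (f : Rd d → ℂ) : Prop :=
  ContDiff ℝ ∞ f ∧ ∀ h : ℝ, 0 < h → BddAbove (Set.range (gsQuot t s h f))

lemma mfact_pos (α : Fin d → ℕ) : 0 < mfact α := Finset.prod_pos fun _ _ => Nat.factorial_pos _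

lemma gsDenom_pos (t s : ℝ) {h : ℝ} (hh : 0 < h) (α β : Fin d → ℕ) :
    0 < h ^ (mlen α + mlen β) * (mfact α : ℝ) ^ t * (mfact β : ℝ) ^ s := by
  have h1 : (0 : ℝ) < mfact α := by exact_mod_cast mfact_pos α
  have h2 : (0 : ℝ) < mfact β := by exact_mod_cast mfact_pos β
  positivity

lemma gsQuot_nonneg (t s : ℝ) {h : ℝ} (hh : 0 < h) (f : Rd d → ℂ) (p) :
    0 ≤ gsQuot t s h f p :=
  div_nonneg (by positivity) (gsDenom_pos t s hh _ _).le

lemma gsQuot_add_le (t s : ℝ) {h : ℝ} (hh : 0 < h) {f g : Rd d → ℂ} (hf : ContDiff ℝ ∞ f)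
    (hg : ContDiff ℝ ∞ g) (p) :
    gsQuot t s h (f + g) p ≤ gsQuot t s h f p + gsQuot t s h g p := by
  unfold gsQuot
  rw [← add_div, ← mul_add, pderiv_add hf hg]
  have := (gsDenom_pos t s hh p.1 p.2.1).le
  gcongr
  exact norm_add_le _ _

lemma gsQuot_smul (t s h : ℝ) {f : Rd d → ℂ} (c : ℂ) (hf : ContDiff ℝ ∞ f) (p) :
    gsQuot t s h (c • f) p = ‖c‖ * gsQuot t s h f p := by
  unfold gsQuot
  rw [pderiv_smul c hf, Pi.smul_apply, norm_smul]
  ring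

/-- `Σ_t^s(ℝ^d)` as a linear subspace of the space of all functions. -/
def gsSubmodule (d : ℕ) (t s : ℝ) : Submodule ℂ (Rd d → ℂ) where
  carrier := {f | IsGS t s f}
  add_mem' := by
    rintro f g ⟨hf, hf'⟩ ⟨hg, hg'⟩
    refine ⟨hf.add hg, fun h hh => ?_⟩
    obtain ⟨A, hA⟩ := hf' h hh
    obtain ⟨B, hB⟩ := hg' h hh
    refine ⟨A + B, ?_⟩
    rintro _ ⟨p, rfl⟩
    exact (gsQuot_add_le t s hh hf hg p).trans (add_le_add (hA ⟨p, rfl⟩) (hB ⟨p, rfl⟩))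
  zero_mem' := by
    have h0 : ContDiff ℝ ∞ (0 : Rd d → ℂ) := contDiff_const
    refine ⟨h0, fun h hh => ⟨0, ?_⟩⟩
    rintro _ ⟨p, rfl⟩
    have := gsQuot_smul t s h 0 h0 p
    simp only [zero_smul, norm_zero, zero_mul] at this
    exact this.le
  smul_mem' := by
    rintro c f ⟨hf, hf'⟩
    refine ⟨contDiff_const.smul hf, fun h hh => ?_⟩
    obtain ⟨A, hA⟩ := hf' h hh
    refine ⟨‖c‖ * A, ?_⟩
    rintro _ ⟨p, rfl⟩
    rw [gsQuot_smul t s h c hf p]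
    exact mul_le_mul_of_nonneg_left (hA ⟨p, rfl⟩) (norm_nonneg c)

/-- The Gelfand–Shilov space `Σ_t^s(ℝ^d)` of Beurling type. (This is a type of its own, so that it
does not inherit the topology of pointwise convergence.) -/
def GelfandShilov (d : ℕ) (t s : ℝ) : Type := gsSubmodule d t s

variable {t s : ℝ}

instance : AddCommGroup (GelfandShilov d t s) := inferInstanceAs (AddCommGroup (gsSubmodule d t s))

instance : Module ℂ (GelfandShilov d t s) := inferInstanceAs (Module ℂ (gsSubmodule d t s))

instance : CoeFun (GelfandShilov d t s) (fun _ => Rd d → ℂ) := ⟨fun f => f.1⟩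

/-- The norm `‖f‖_h = sup |x^α ∂^β f(x)| / (h^{|α+β|} α!^t β!^s)`, as a seminorm on
`Σ_t^s(ℝ^d)`, for each `h > 0`. -/
def gsSeminorm (d : ℕ) (t s : ℝ) : SeminormFamily ℂ (GelfandShilov d t s) {h : ℝ // 0 < h} :=
  fun h => Seminorm.of (fun f => ⨆ p, gsQuot t s h.1 (f : Rd d → ℂ) p)
    (by
      rintro ⟨f, hf⟩ ⟨g, hg⟩
      refine ciSup_le fun p => ?_
      refine (gsQuot_add_le t s h.2 hf.1 hg.1 p).trans ?_
      exact add_le_add (le_ciSup (hf.2 h.1 h.2) p) (le_ciSup (hg.2 h.1 h.2) p))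
    (by
      rintro c ⟨f, hf⟩
      have : ∀ p, gsQuot t s h.1 (c • f) p = ‖c‖ * gsQuot t s h.1 f p :=
        fun p => gsQuot_smul t s h.1 c hf.1 p
      calc (⨆ p, gsQuot t s h.1 (c • f) p) = ⨆ p, ‖c‖ * gsQuot t s h.1 f p := by simp_rw [this]
        _ = ‖c‖ * ⨆ p, gsQuot t s h.1 f p := (Real.mul_iSup_of_nonneg (norm_nonneg c) _).symm)

instance : Nonempty {h : ℝ // 0 < h} := ⟨⟨1, one_pos⟩⟩

/-- The Fréchet topology of `Σ_t^s(ℝ^d)`, defined by the seminorms `‖·‖_h`, `h > 0`. -/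
instance : TopologicalSpace (GelfandShilov d t s) := (gsSeminorm d t s).moduleFilterBasis.topology

lemma withSeminorms_gs : WithSeminorms (gsSeminorm d t s) := ⟨rfl⟩

/-- The space `(Σ_t^s)'(ℝ^d)` of Gelfand–Shilov ultradistributions. An ultradistribution `u` is a
continuous functional `φ ↦ (u, φ)`, which by convention is conjugate linear, consistent with
the `L²` inner product that is conjugate linear in the second argument. -/
abbrev Ultradistribution (d : ℕ) (t s : ℝ) : Type := GelfandShilov d t s →L⋆[ℂ] ℂ

/-- The ultradistribution `u` is (given by) the function `f`:
`(u, φ) = ∫ f(x) \overline{φ(x)} dx`, with absolutely convergent integrals,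
for all `φ ∈ Σ_t^s(ℝ^d)`. -/
def IsGivenBy (u : Ultradistribution d t s) (f : Rd d → ℂ) : Prop :=
  ∀ φ : GelfandShilov d t s,
    MeasureTheory.Integrable (fun x => f x * starRingEnd ℂ (φ x)) ∧
      u φ = ∫ x, f x * starRingEnd ℂ (φ x)

/-! ### Invariance of `Σ_t^s(ℝ^d)` under translation and modulation -/

/-- Translation `T_x f(y) = f(y - x)`. -/
def translate (x : Rd d) (f : Rd d → ℂ) : Rd d → ℂ := fun y => f (y - x)

/-- Modulation `M_ξ f(y) = e^{i⟨y, ξ⟩} f(y)`. -/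
def modulate (ξ : Rd d) (f : Rd d → ℂ) : Rd d → ℂ :=
  fun y => Complex.exp (Complex.I * ((inner ℝ y ξ : ℝ) : ℂ)) * f y

lemma isGS_iff {f : Rd d → ℂ} : IsGS t s f ↔ ContDiff ℝ ∞ f ∧ ∀ h : ℝ, 0 < h →
    ∃ C : ℝ, 0 ≤ C ∧ ∀ α β x, |monom α x| * ‖pderiv β f x‖ ≤
      C * (h ^ (mlen α + mlen β) * (mfact α : ℝ) ^ t * (mfact β : ℝ) ^ s) := by
  refine and_congr_right fun _ => forall₂_congr fun h hh => ⟨?_, ?_⟩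
  · rintro ⟨C, hC⟩
    refine ⟨C, (gsQuot_nonneg t s hh f (0, 0, 0)).trans (hC ⟨_, rfl⟩), fun α β x => ?_⟩
    exact (div_le_iff₀ (gsDenom_pos t s hh α β)).1 (hC ⟨(α, β, x), rfl⟩)
  · rintro ⟨C, _, hC⟩
    refine ⟨C, ?_⟩
    rintro _ ⟨⟨α, β, x⟩, rfl⟩
    exact (div_le_iff₀ (gsDenom_pos t s hh α β)).2 (hC α β x)

lemma pow_le_factorial_rpow {h a : ℝ} (hh : 0 < h) (hs : 0 < s) (ha : 0 ≤ a) :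
    ∃ C : ℝ, 0 ≤ C ∧ ∀ m : ℕ, a ^ m ≤ C * (h ^ m * (m.factorial : ℝ) ^ s) := by
  refine ⟨(Real.exp ((a / h) ^ (1 / s))) ^ s, by positivity, fun m => ?_⟩
  have hf : (0 : ℝ) < m.factorial := by exact_mod_cast m.factorial_pos
  have h0 : 0 ≤ a / h := by positivity
  have h1 := Real.pow_div_factorial_le_exp (x := (a / h) ^ (1 / s)) (by positivity) m
  rw [div_le_iff₀ hf] at h1
  have h2 := Real.rpow_le_rpow (by positivity) h1 hs.le
  rw [Real.mul_rpow (by positivity) hf.le] at h2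
  have h3 : (((a / h) ^ (1 / s)) ^ m) ^ s = (a / h) ^ m := by
    rw [← Real.rpow_natCast, ← Real.rpow_mul h0, ← Real.rpow_mul h0, ← Real.rpow_natCast]
    congr 1
    field_simp
  rw [h3, div_pow, div_le_iff₀ (by positivity)] at h2
  linarith

lemma sum_choose_le {a A B q : ℝ} (hq : 0 ≤ q) (hA : 0 ≤ A) (hB : 0 ≤ B) (ha : 0 ≤ a)
    (hs : 0 < s) (b : ℕ → ℝ)
    (h1 : ∀ k, b k ≤ A * (q ^ k * (k.factorial : ℝ) ^ s))
    (h2 : ∀ m, a ^ m ≤ B * (q ^ m * (m.factorial : ℝ) ^ s)) (n : ℕ) :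
    ∑ ij ∈ Finset.HasAntidiagonal.antidiagonal n, n.choose ij.1 • (a ^ ij.1 * b ij.2) ≤
      B * A * ((2 * q) ^ n * (n.factorial : ℝ) ^ s) := by
  have key : ∀ ij ∈ Finset.HasAntidiagonal.antidiagonal n, n.choose ij.1 • (a ^ ij.1 * b ij.2) ≤
      n.choose ij.1 • (B * A * (q ^ n * (n.factorial : ℝ) ^ s)) := by
    rintro ⟨i, j⟩ hij
    rw [Finset.HasAntidiagonal.mem_antidiagonal] at hij
    simp only at hij
    subst hij
    refine nsmul_le_nsmul_right ?_ _
    have hfac : ((i.factorial : ℝ)) ^ s * (j.factorial : ℝ) ^ s ≤ ((i + j).factorial : ℝ) ^ s := by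
      rw [← Real.mul_rpow (by positivity) (by positivity)]
      refine Real.rpow_le_rpow (by positivity) ?_ hs.le
      exact_mod_cast Nat.le_of_dvd (Nat.factorial_pos _) (Nat.factorial_mul_factorial_dvd_factorial_add i j)
    calc a ^ i * b j ≤ a ^ i * (A * (q ^ j * (j.factorial : ℝ) ^ s)) := by
          gcongr; exact h1 j
      _ ≤ (B * (q ^ i * (i.factorial : ℝ) ^ s)) * (A * (q ^ j * (j.factorial : ℝ) ^ s)) := by
          gcongr; exact h2 i
      _ = B * A * (q ^ (i + j) * ((i.factorial : ℝ) ^ s * (j.factorial : ℝ) ^ s)) := by ring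
      _ ≤ _ := by gcongr
  refine (Finset.sum_le_sum key).trans (le_of_eq ?_)
  rw [← Finset.sum_smul, Finset.Nat.sum_antidiagonal_eq_sum_range_succ_mk]
  simp only [Nat.sum_range_choose, nsmul_eq_mul]
  push_cast
  ring

lemma mlen_update (j : Fin d) (k : ℕ) (α : Fin d → ℕ) :
    mlen (Function.update α j k) = k + mlen (Function.update α j 0) := by
  simp [mlen, Finset.sum_update_of_mem]

lemma mfact_update (j : Fin d) (k : ℕ) (α : Fin d → ℕ) :
    mfact (Function.update α j k) = k.factorial * mfact (Function.update α j 0) := by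
  unfold mfact
  have : ∀ k, ∏ i, (Function.update α j k i).factorial =
      ∏ i, Function.update (fun i => (α i).factorial) j k.factorial i := by
    intro k
    refine Finset.prod_congr rfl fun i _ => ?_
    by_cases h : i = j
    · subst h; simp
    · simp [h]
  simp [this, Finset.prod_update_of_mem]

lemma monom_split (j : Fin d) (k : ℕ) (α : Fin d → ℕ) (x : Rd d) :
    monom (Function.update α j k) x = x j ^ k * monom (Function.update α j 0) x := by
  unfold monom
  have : ∀ k, ∏ i, x i ^ (Function.update α j k i) =
      ∏ i, Function.update (fun i => x i ^ α i) j (x j ^ k) i := by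
    intro k
    refine Finset.prod_congr rfl fun i _ => ?_
    by_cases h : i = j
    · subst h; simp
    · simp [h]
  simp [this, Finset.prod_update_of_mem]

/-- Multiplication by `e^{i c x_j}`. -/
def modCoord (j : Fin d) (c : ℝ) (f : Rd d → ℂ) : Rd d → ℂ :=
  fun x => Complex.exp (Complex.I * ((c * x j : ℝ) : ℂ)) * f x

lemma contDiff_modCoord (j : Fin d) (c : ℝ) {f : Rd d → ℂ} (hf : ContDiff ℝ ∞ f) :
    ContDiff ℝ ∞ (modCoord j c f) := by
  unfold modCoord
  refine ContDiff.mul ?_ hf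
  refine ContDiff.cexp (contDiff_const.mul (Complex.ofRealCLM.contDiff.comp ?_))
  exact contDiff_const.mul (EuclideanSpace.proj (𝕜 := ℝ) j : Rd d →L[ℝ] ℝ).contDiff

lemma norm_modCoord (j : Fin d) (c : ℝ) (f : Rd d → ℂ) (x : Rd d) :
    ‖modCoord j c f x‖ = ‖f x‖ := by
  unfold modCoord
  rw [norm_mul, mul_comm Complex.I, Complex.norm_exp_ofReal_mul_I, one_mul]

lemma pd_modCoord (i j : Fin d) (c : ℝ) {f : Rd d → ℂ} (hf : ContDiff ℝ ∞ f) :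
    pd i (modCoord j c f) = modCoord j c (pd i f) +
      (if i = j then Complex.I * (c : ℂ) else 0) • modCoord j c f := by
  funext x
  have hl : HasFDerivAt (fun x : Rd d => x j) (EuclideanSpace.proj (𝕜 := ℝ) j : Rd d →L[ℝ] ℝ) x :=
    (EuclideanSpace.proj (𝕜 := ℝ) j : Rd d →L[ℝ] ℝ).hasFDerivAt
  have h1 := Complex.ofRealCLM.hasFDerivAt.comp x (hl.const_mul c)
  have h2 := (h1.const_mul Complex.I).cexp
  have h3 := h2.mul (hf.differentiable (by simp) x).hasFDerivAt
  have h4 : fderiv ℝ (modCoord j c f) x = _ := h3.fderiv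
  unfold pd
  rw [h4]
  by_cases hij : i = j
  · subst hij
    simp [modCoord]
    ring
  · have hji : ¬ j = i := fun h => hij h.symm
    simp [modCoord, hij, hji]

lemma pd_iterate_modCoord_ne {i j : Fin d} (hij : i ≠ j) (c : ℝ) {f : Rd d → ℂ}
    (hf : ContDiff ℝ ∞ f) (n : ℕ) :
    (pd i)^[n] (modCoord j c f) = modCoord j c ((pd i)^[n] f) := by
  induction n with
  | zero => rfl
  | succ n ih =>
    rw [Function.iterate_succ_apply', Function.iterate_succ_apply', ih,
      pd_modCoord i j c (contDiff_pd_iterate hf i n)]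
    simp [hij]

lemma pdList_modCoord (j : Fin d) (c : ℝ) {f : Rd d → ℂ} (hf : ContDiff ℝ ∞ f) (β : Fin d → ℕ)
    (hβ : β j = 0) (l : List (Fin d)) :
    pdList l β (modCoord j c f) = modCoord j c (pdList l β f) := by
  induction l with
  | nil => rfl
  | cons i l ih =>
    have hc := contDiff_pdList hf l β
    simp only [pdList, List.foldr_cons] at ih hc ⊢
    rw [ih]
    by_cases hij : i = j
    · subst hij; rw [hβ]; rfl
    · exact pd_iterate_modCoord_ne hij c hc _

lemma norm_pd_iterate_modCoord_le (j : Fin d) (c : ℝ) (x : Rd d) (n : ℕ) :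
    ∀ g : Rd d → ℂ, ContDiff ℝ ∞ g → ‖(pd j)^[n] (modCoord j c g) x‖ ≤
      ∑ ij ∈ Finset.HasAntidiagonal.antidiagonal n, n.choose ij.1 • (|c| ^ ij.1 * ‖(pd j)^[ij.2] g x‖) := by
  induction n with
  | zero => intro g _; simp [norm_modCoord]
  | succ n ih =>
    intro g hg
    rw [Finset.sum_antidiagonal_choose_succ_nsmul (fun i k => |c| ^ i * ‖(pd j)^[k] g x‖) n]
    have hg' := contDiff_modCoord j c hg
    have hg'' : ContDiff ℝ ∞ ((if j = j then Complex.I * (c : ℂ) else 0) • modCoord j c g) :=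
      contDiff_const.smul hg'
    rw [Function.iterate_succ_apply, pd_modCoord j j c hg,
      pd_iterate_add (contDiff_modCoord j c (contDiff_pd hg j)) hg'',
      pd_iterate_smul _ hg']
    refine (norm_add_le _ _).trans (add_le_add ?_ ?_)
    · exact ih _ (contDiff_pd hg j)
    · have h1 := ih g hg
      have h2 : ‖((if j = j then Complex.I * (c : ℂ) else 0) •
          (pd j)^[n] (modCoord j c g)) x‖ = |c| * ‖(pd j)^[n] (modCoord j c g) x‖ := by
        simp
      rw [h2]
      refine (mul_le_mul_of_nonneg_left h1 (abs_nonneg c)).trans (le_of_eq ?_)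
      rw [Finset.mul_sum]
      refine Finset.sum_congr rfl ?_
      rintro ⟨i, k⟩ hik
      rw [n.choose_symm_of_eq_add (Finset.HasAntidiagonal.mem_antidiagonal.1 hik).symm]
      simp only [nsmul_eq_mul]
      ring

lemma isGS_modCoord (hs : 0 < s) (j : Fin d) (c : ℝ) {f : Rd d → ℂ} (hf : IsGS t s f) :
    IsGS t s (modCoord j c f) := by
  rw [isGS_iff] at hf ⊢
  obtain ⟨hf, hb⟩ := hf
  refine ⟨contDiff_modCoord j c hf, fun h hh => ?_⟩
  obtain ⟨A, hA0, hA⟩ := hb (h / 2) (by positivity)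
  obtain ⟨B, hB0, hB⟩ := pow_le_factorial_rpow (s := s) (a := |c|) (half_pos hh) hs (abs_nonneg c)
  refine ⟨B * A, by positivity, fun α β x => ?_⟩
  set β₀ := Function.update β j 0 with hβ₀
  have hβ : ∀ k, pderiv (Function.update β j k) f x = (pd j)^[k] (pderiv β₀ f) x := by
    intro k
    rw [pderiv_split j _ hf]
    simp [hβ₀]
  have hfa : (0 : ℝ) < mfact α := by exact_mod_cast mfact_pos α
  have hfb : (0 : ℝ) < mfact β₀ := by exact_mod_cast mfact_pos β₀
  have hm : mlen β = β j + mlen β₀ := by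
    have := mlen_update j (β j) β
    rwa [Function.update_eq_self] at this
  have hfm : mfact β = (β j).factorial * mfact β₀ := by
    have := mfact_update j (β j) β
    rwa [Function.update_eq_self] at this
  have h1 : ‖pderiv β (modCoord j c f) x‖ ≤
      ∑ ij ∈ Finset.HasAntidiagonal.antidiagonal (β j), (β j).choose ij.1 •
        (|c| ^ ij.1 * ‖(pd j)^[ij.2] (pderiv β₀ f) x‖) := by
    rw [pderiv_split j β (contDiff_modCoord j c hf), pderiv, pdList_modCoord j c hf _ (by simp)]
    exact norm_pd_iterate_modCoord_le j c x (β j) _ (contDiff_pderiv hf β₀)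
  have h2 := sum_choose_le (q := h / 2) (a := |c|) (B := B)
    (A := A * ((h / 2) ^ (mlen α + mlen β₀) * (mfact α : ℝ) ^ t * (mfact β₀ : ℝ) ^ s))
    (by positivity) (by positivity) hB0 (abs_nonneg c) hs
    (fun k => |monom α x| * ‖(pd j)^[k] (pderiv β₀ f) x‖)
    (by
      intro k
      have := hA α (Function.update β j k) x
      rw [hβ, mlen_update, mfact_update] at this
      refine this.trans (le_of_eq ?_)
      push_cast
      rw [Real.mul_rpow (by positivity) (by positivity)]
      ring) hB (β j)
  calc |monom α x| * ‖pderiv β (modCoord j c f) x‖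
      ≤ |monom α x| * ∑ ij ∈ Finset.HasAntidiagonal.antidiagonal (β j), (β j).choose ij.1 •
          (|c| ^ ij.1 * ‖(pd j)^[ij.2] (pderiv β₀ f) x‖) := by gcongr
    _ = ∑ ij ∈ Finset.HasAntidiagonal.antidiagonal (β j), (β j).choose ij.1 •
          (|c| ^ ij.1 * (|monom α x| * ‖(pd j)^[ij.2] (pderiv β₀ f) x‖)) := by
        rw [Finset.mul_sum]
        refine Finset.sum_congr rfl fun _ _ => ?_
        simp only [nsmul_eq_mul]
        ring
    _ ≤ _ := h2
    _ ≤ B * (A * (h ^ (mlen α + mlen β₀) * (mfact α : ℝ) ^ t * (mfact β₀ : ℝ) ^ s)) *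
          ((2 * (h / 2)) ^ (β j) * ((β j).factorial : ℝ) ^ s) := by
        gcongr
        linarith
    _ = _ := by
        rw [hm, hfm]
        push_cast
        rw [Real.mul_rpow (by positivity) (by positivity)]
        ring

lemma pd_translate (i : Fin d) (a : Rd d) (f : Rd d → ℂ) :
    pd i (translate a f) = translate a (pd i f) := by
  funext x
  have h : fderiv ℝ (translate a f) x = fderiv ℝ f (x - a) := fderiv_comp_sub a
  simp only [pd, translate] at h ⊢
  rw [h]

lemma pdList_translate (a : Rd d) (f : Rd d → ℂ) (β : Fin d → ℕ) (l : List (Fin d)) :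
    pdList l β (translate a f) = translate a (pdList l β f) := by
  have hit : ∀ (i : Fin d) (n : ℕ) (g : Rd d → ℂ),
      (pd i)^[n] (translate a g) = translate a ((pd i)^[n] g) := by
    intro i n g
    induction n with
    | zero => rfl
    | succ n ih => rw [Function.iterate_succ_apply', Function.iterate_succ_apply', ih, pd_translate]
  induction l with
  | nil => rfl
  | cons i l ih =>
    simp only [pdList, List.foldr_cons] at ih ⊢
    rw [ih, hit]

lemma isGS_translate_single (ht : 0 < t) (j : Fin d) (a : ℝ) {f : Rd d → ℂ} (hf : IsGS t s f) :
    IsGS t s (translate (EuclideanSpace.single j a) f) := by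
  rw [isGS_iff] at hf ⊢
  obtain ⟨hf, hb⟩ := hf
  refine ⟨hf.comp (contDiff_id.sub contDiff_const), fun h hh => ?_⟩
  obtain ⟨A, hA0, hA⟩ := hb (h / 2) (by positivity)
  obtain ⟨B, hB0, hB⟩ := pow_le_factorial_rpow (s := t) (a := |a|) (half_pos hh) ht (abs_nonneg a)
  refine ⟨B * A, by positivity, fun α β x => ?_⟩
  set α₀ := Function.update α j 0 with hα₀
  set y := x - EuclideanSpace.single j a with hy
  have hfa : (0 : ℝ) < mfact α₀ := by exact_mod_cast mfact_pos α₀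
  have hfb : (0 : ℝ) < mfact β := by exact_mod_cast mfact_pos β
  have hm : mlen α = α j + mlen α₀ := by
    have := mlen_update j (α j) α
    rwa [Function.update_eq_self] at this
  have hfm : mfact α = (α j).factorial * mfact α₀ := by
    have := mfact_update j (α j) α
    rwa [Function.update_eq_self] at this
  have hmon : monom α x = x j ^ (α j) * monom α₀ x := by
    have := monom_split j (α j) α x
    rwa [Function.update_eq_self] at this
  have hxy : x j = a + y j := by simp [hy]
  have hmon₀ : monom α₀ x = monom α₀ y := by
    unfold monom
    refine Finset.prod_congr rfl fun i _ => ?_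
    by_cases hij : i = j
    · subst hij; simp [hα₀]
    · simp [hy, hij]
  have hder : pderiv β (translate (EuclideanSpace.single j a) f) x = pderiv β f y := by
    rw [pderiv, pdList_translate]; rfl
  have h2 := sum_choose_le (q := h / 2) (a := |a|) (B := B)
    (A := A * ((h / 2) ^ (mlen α₀ + mlen β) * (mfact α₀ : ℝ) ^ t * (mfact β : ℝ) ^ s))
    (by positivity) (by positivity) hB0 (abs_nonneg a) ht
    (fun k => |y j| ^ k * (|monom α₀ y| * ‖pderiv β f y‖))
    (by
      intro k
      have := hA (Function.update α j k) β y
      rw [monom_split, mlen_update, mfact_update, abs_mul, abs_pow] at this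
      rw [← mul_assoc]
      refine this.trans (le_of_eq ?_)
      push_cast
      rw [Real.mul_rpow (by positivity) (by positivity)]
      ring) hB (α j)
  calc |monom α x| * ‖pderiv β (translate (EuclideanSpace.single j a) f) x‖
      = |a + y j| ^ (α j) * (|monom α₀ y| * ‖pderiv β f y‖) := by
        rw [hder, hmon, hmon₀, hxy, abs_mul, abs_pow]; ring
    _ ≤ (|a| + |y j|) ^ (α j) * (|monom α₀ y| * ‖pderiv β f y‖) := by
        gcongr
        exact abs_add_le _ _
    _ = ∑ ij ∈ Finset.HasAntidiagonal.antidiagonal (α j), (α j).choose ij.1 •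
          (|a| ^ ij.1 * (|y j| ^ ij.2 * (|monom α₀ y| * ‖pderiv β f y‖))) := by
        rw [(Commute.all (|a|) (|y j|)).add_pow', Finset.sum_mul]
        refine Finset.sum_congr rfl fun _ _ => ?_
        simp only [nsmul_eq_mul]
        ring
    _ ≤ _ := h2
    _ ≤ B * (A * (h ^ (mlen α₀ + mlen β) * (mfact α₀ : ℝ) ^ t * (mfact β : ℝ) ^ s)) *
          ((2 * (h / 2)) ^ (α j) * ((α j).factorial : ℝ) ^ t) := by
        gcongr
        linarith
    _ = _ := by
        rw [hm, hfm]
        push_cast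
        rw [Real.mul_rpow (by positivity) (by positivity)]
        ring

lemma isGS_translate (ht : 0 < t) (x : Rd d) {f : Rd d → ℂ} (hf : IsGS t s f) :
    IsGS t s (translate x f) := by
  have key : ∀ S : Finset (Fin d),
      IsGS t s (translate (∑ j ∈ S, EuclideanSpace.single j (x j)) f) := by
    intro S
    induction S using Finset.induction_on with
    | empty =>
      have h0 : translate (0 : Rd d) f = f := by funext y; simp [translate]
      rwa [Finset.sum_empty, h0]
    | insert j S hj ih =>
      have := isGS_translate_single ht j (x j) ih
      convert this using 1
      funext y
      simp [translate, Finset.sum_insert hj, sub_sub]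
  have hx : (∑ j, EuclideanSpace.single j (x j) : Rd d) = x := by
    ext i
    simp [Finset.sum_apply, Pi.single_apply]
  have := key Finset.univ
  rwa [hx] at this

lemma isGS_modulate (hs : 0 < s) (ξ : Rd d) {f : Rd d → ℂ} (hf : IsGS t s f) :
    IsGS t s (modulate ξ f) := by
  have key : ∀ S : Finset (Fin d),
      IsGS t s (fun y => Complex.exp (Complex.I * ((∑ j ∈ S, ξ j * y j : ℝ) : ℂ)) * f y) := by
    intro S
    induction S using Finset.induction_on with
    | empty => simpa using hf
    | insert j S hj ih =>
      have := isGS_modCoord hs j (ξ j) ih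
      convert this using 1
      funext y
      rw [Finset.sum_insert hj]
      simp only [modCoord]
      rw [← mul_assoc, ← Complex.exp_add]
      push_cast
      ring_nf
  have := key Finset.univ
  convert this using 1
  funext y
  simp [modulate, PiLp.inner_apply, mul_comm]

/-- The time-frequency shift `M_ξ T_x φ ∈ Σ_t^s(ℝ^d)` of `φ ∈ Σ_t^s(ℝ^d)`, for `t, s > 0`. -/
def tfShift (ht : 0 < t) (hs : 0 < s) (x ξ : Rd d) (φ : GelfandShilov d t s) :
    GelfandShilov d t s :=
  ⟨modulate ξ (translate x φ), isGS_modulate hs ξ (isGS_translate ht x φ.2)⟩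

/-! ### The short-time Fourier transform and the wave front set -/

/-- The short-time Fourier transform `V_ψ u(x, ξ) = (2π)^{-d/2} (u, M_ξ T_x ψ)`. -/
def stft (ht : 0 < t) (hs : 0 < s) (ψ : GelfandShilov d t s) (u : Ultradistribution d t s)
    (x ξ : Rd d) : ℂ :=
  (((2 * Real.pi) ^ (-(d : ℝ) / 2) : ℝ) : ℂ) * u (tfShift ht hs x ξ ψ)

/-- The `t,s`-Gelfand–Shilov wave front set `WF^{t,s}(u)`, computed with the window `ψ`:
`z₀ ∈ T^*ℝ^d ∖ 0` does not belong to it iff there is an open set `U ⊆ T^*ℝ^d ∖ 0` containing `z₀`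
such that `sup_{λ > 0, (x, ξ) ∈ U} e^{rλ} |V_ψ u(λ^t x, λ^s ξ)| < ∞` for every `r > 0`. -/
def waveFrontSet (ht : 0 < t) (hs : 0 < s) (ψ : GelfandShilov d t s)
    (u : Ultradistribution d t s) : Set (Rd d × Rd d) :=
  {z₀ | z₀ ≠ 0 ∧ ¬ ∃ U : Set (Rd d × Rd d), IsOpen U ∧ 0 ∉ U ∧ z₀ ∈ U ∧
    ∀ r : ℝ, 0 < r → ∃ C : ℝ, ∀ lam : ℝ, 0 < lam → ∀ z ∈ U,
      Real.exp (r * lam) * ‖stft ht hs ψ u (lam ^ t • z.1) (lam ^ s • z.2)‖ ≤ C}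

end GS

end

/-!
Write `G(z) = (u, M_ξ T_x ψ)` and `(V_ψ φ)(z) = (φ, M_ξ T_x ψ)` for `z = (x, ξ)`. By continuity, `u`
factors through a Banach space of weighted derivatives, in which the Gabor inversion formula
`(2π)^d ‖ψ‖² φ = ∫ (V_ψ φ)(z) M_ξ T_x ψ dz` converges absolutely; applying `u` under the integral
sign gives `(2π)^d ‖ψ‖² (u, φ) = ∫ G(z) conj((V_ψ φ)(z)) dz`.

A priori `G` is only bounded by `e^{r (|x|^{1/t} + |ξ|^{1/s})}` for some `r`. Since the wave front
set does not meet `{0} × (ℝ^d ∖ 0)`, compactness of the unit sphere makes `G` decay faster than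
every `e^{-r |ξ|^{1/s}}` on a set `|x| < ε |ξ|^{t/s}`. Off this set `|ξ|^{1/s} ≲ |x|^{1/t}`, so
there the decay in `ξ` may be bought with growth in `x`. This growth is compensated by the window,
so that `∫ G(z) M_ξ T_x ψ(y) dz` converges together with all its derivatives in `y`; by Fubini's
theorem it represents `(2π)^d ‖ψ‖² u`.
-/

noncomputable section

namespace GS

open MeasureTheory
open scoped FourierTransform

variable {d : ℕ} {t s : ℝ}

/-! ### Multi-indices and partial derivatives -/

lemma mlen_zero : mlen (0 : Fin d → ℕ) = 0 := by simp [mlen]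

lemma mfact_zero : mfact (0 : Fin d → ℕ) = 1 := by simp [mfact]

lemma monom_zero (x : Rd d) : monom 0 x = 1 := by simp [monom]

lemma mlen_add (β γ : Fin d → ℕ) : mlen (β + γ) = mlen β + mlen γ := Finset.sum_add_distrib

lemma mlen_single (i : Fin d) (n : ℕ) : mlen (Pi.single i n) = n := by simp [mlen]

lemma monom_add (β γ : Fin d → ℕ) (x : Rd d) : monom (β + γ) x = monom β x * monom γ x := by
  simp only [monom, Pi.add_apply, pow_add, Finset.prod_mul_distrib]

lemma monom_single (i : Fin d) (n : ℕ) (x : Rd d) : monom (Pi.single i n) x = x i ^ n := by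
  rw [Pi.single, monom_split]
  exact (congrArg _ (by rw [Function.update_zero, monom_zero])).trans (mul_one _)

lemma mfact_single (i : Fin d) (n : ℕ) : mfact (Pi.single i n) = n.factorial := by
  rw [Pi.single, mfact_update]
  exact (congrArg _ (by rw [Function.update_zero, mfact_zero])).trans (mul_one _)

lemma mfact_mul_mfact_le (β γ : Fin d → ℕ) : mfact β * mfact γ ≤ mfact (β + γ) := by
  rw [mfact, mfact, mfact, ← Finset.prod_mul_distrib]
  exact Finset.prod_le_prod' fun i _ =>
    Nat.le_of_dvd (Nat.factorial_pos _) (Nat.factorial_mul_factorial_dvd_factorial_add _ _)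

lemma multiIndex_induction {P : (Fin d → ℕ) → Prop} (zero : P 0)
    (add_single : ∀ β i, P β → P (β + Pi.single i 1)) (β : Fin d → ℕ) : P β := by
  induction h : mlen β generalizing β with
  | zero =>
    have : β = 0 := funext fun i => Finset.sum_eq_zero_iff.1 h i (Finset.mem_univ i)
    exact this ▸ zero
  | succ n ih =>
    obtain ⟨i, -, hi⟩ : ∃ i ∈ Finset.univ, β i ≠ 0 :=
      Finset.exists_ne_zero_of_sum_ne_zero (h.trans_ne n.succ_ne_zero)
    have hβ : β = β - Pi.single i 1 + Pi.single i 1 := by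
      refine (tsub_add_cancel_of_le fun j => ?_).symm
      rcases eq_or_ne j i with rfl | hj
      · simpa using Nat.one_le_iff_ne_zero.2 hi
      · simp [hj]
    rw [hβ]
    refine add_single _ i (ih _ ?_)
    rw [hβ, mlen_add, mlen_single] at h
    exact Nat.succ_injective h

lemma pderiv_zero (f : Rd d → ℂ) : pderiv 0 f = f := by
  unfold pderiv
  induction List.finRange d with
  | nil => rfl
  | cons _ _ ih => exact ih

lemma pderiv_add_single (β : Fin d → ℕ) (i : Fin d) {f : Rd d → ℂ} (hf : ContDiff ℝ ∞ f) :
    pderiv (β + Pi.single i 1) f = pd i (pderiv β f) := by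
  have hup : Function.update (β + Pi.single i 1) i 0 = Function.update β i 0 := by
    ext j
    rcases eq_or_ne j i with rfl | hj <;> simp [*]
  rw [pderiv_split i _ hf, hup, pderiv_split i β hf, ← Function.iterate_succ_apply' (pd i)]
  simp

lemma pderiv_pd (β : Fin d → ℕ) (i : Fin d) {f : Rd d → ℂ} (hf : ContDiff ℝ ∞ f) :
    pderiv β (pd i f) = pderiv (β + Pi.single i 1) f := by
  induction β using multiIndex_induction with
  | zero => rw [pderiv_zero, pderiv_add_single 0 i hf, pderiv_zero]
  | add_single β j ih =>
    rw [pderiv_add_single β j (contDiff_pd hf i), ih, ← pderiv_add_single _ j hf, add_right_comm]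

lemma pderiv_translate (β : Fin d → ℕ) (x : Rd d) (f : Rd d → ℂ) :
    pderiv β (translate x f) = translate x (pderiv β f) :=
  pdList_translate x f β _

lemma contDiff_translate (x : Rd d) {f : Rd d → ℂ} (hf : ContDiff ℝ ∞ f) :
    ContDiff ℝ ∞ (translate x f) :=
  hf.comp (contDiff_id.sub contDiff_const)

lemma contDiff_conj {f : Rd d → ℂ} (hf : ContDiff ℝ ∞ f) :
    ContDiff ℝ ∞ (fun x => starRingEnd ℂ (f x)) :=
  Complex.conjCLE.contDiff.comp hf

lemma pd_conj (i : Fin d) {f : Rd d → ℂ} (hf : ContDiff ℝ ∞ f) :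
    pd i (fun x => starRingEnd ℂ (f x)) = fun x => starRingEnd ℂ (pd i f x) := by
  funext x
  exact congrArg (fun T => T (EuclideanSpace.single i 1))
    (((Complex.conjCLE : ℂ →L[ℝ] ℂ).hasFDerivAt.comp x
      (hf.differentiable (by simp) x).hasFDerivAt).fderiv)

lemma pderiv_conj (β : Fin d → ℕ) {f : Rd d → ℂ} (hf : ContDiff ℝ ∞ f) :
    pderiv β (fun x => starRingEnd ℂ (f x)) = fun x => starRingEnd ℂ (pderiv β f x) := by
  induction β using multiIndex_induction with
  | zero => simp only [pderiv_zero]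
  | add_single β i ih =>
    rw [pderiv_add_single β i (contDiff_conj hf), ih, pd_conj i (contDiff_pderiv hf β),
      pderiv_add_single β i hf]

lemma pd_mul (i : Fin d) {f g : Rd d → ℂ} (hf : ContDiff ℝ ∞ f) (hg : ContDiff ℝ ∞ g) :
    pd i (f * g) = f * pd i g + pd i f * g := by
  funext x
  have h : fderiv ℝ (f * g) x = _ := ((hf.differentiable (by simp) x).hasFDerivAt.mul
    (hg.differentiable (by simp) x).hasFDerivAt).fderiv
  simp only [pd, h, Pi.add_apply, Pi.mul_apply]
  simp [mul_comm]

lemma norm_pderiv_mul_pderiv_le {A B k : ℝ} (hk : 0 ≤ k) (hs : 0 ≤ s) {f g : Rd d → ℂ}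
    (hf : ContDiff ℝ ∞ f) (hg : ContDiff ℝ ∞ g) {x : Rd d}
    (hfA : ∀ γ, ‖pderiv γ f x‖ ≤ A * (k ^ mlen γ * (mfact γ : ℝ) ^ s))
    (hgB : ∀ δ, ‖pderiv δ g x‖ ≤ B * (k ^ mlen δ * (mfact δ : ℝ) ^ s)) (β γ δ : Fin d → ℕ) :
    ‖pderiv β (pderiv γ f * pderiv δ g) x‖ ≤
      A * B * 2 ^ mlen β * (k ^ mlen (β + γ + δ) * (mfact (β + γ + δ) : ℝ) ^ s) := by
  induction β using multiIndex_induction generalizing γ δ with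
  | zero =>
    have hA : 0 ≤ A := by simpa [mlen_zero, mfact_zero] using (norm_nonneg _).trans (hfA 0)
    have hB : 0 ≤ B := by simpa [mlen_zero, mfact_zero] using (norm_nonneg _).trans (hgB 0)
    have hfact : (mfact γ : ℝ) ^ s * (mfact δ : ℝ) ^ s ≤ (mfact (γ + δ) : ℝ) ^ s := by
      rw [← Real.mul_rpow (by positivity) (by positivity)]
      exact Real.rpow_le_rpow (by positivity) (mod_cast mfact_mul_mfact_le γ δ) hs
    rw [pderiv_zero, Pi.mul_apply, norm_mul, zero_add, mlen_zero, mlen_add, pow_zero, pow_add,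
      mul_one]
    calc ‖pderiv γ f x‖ * ‖pderiv δ g x‖
      _ ≤ A * (k ^ mlen γ * (mfact γ : ℝ) ^ s) * (B * (k ^ mlen δ * (mfact δ : ℝ) ^ s)) :=
        mul_le_mul (hfA γ) (hgB δ) (norm_nonneg _) (by positivity)
      _ = A * B * (k ^ mlen γ * k ^ mlen δ * ((mfact γ : ℝ) ^ s * (mfact δ : ℝ) ^ s)) := by ring
      _ ≤ _ := by gcongr
  | add_single β i ih =>
    have hmul : ∀ γ δ, ContDiff ℝ ∞ (pderiv γ f * pderiv δ g) := fun γ δ =>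
      (contDiff_pderiv hf γ).mul (contDiff_pderiv hg δ)
    rw [← pderiv_pd β i (hmul γ δ), pd_mul i (contDiff_pderiv hf γ) (contDiff_pderiv hg δ),
      ← pderiv_add_single δ i hg, ← pderiv_add_single γ i hf, pderiv_add (hmul _ _) (hmul _ _),
      Pi.add_apply]
    refine ((norm_add_le _ _).trans (add_le_add (ih γ _) (ih _ δ))).trans_eq ?_
    rw [show β + γ + (δ + Pi.single i 1) = β + Pi.single i 1 + γ + δ by abel,
      show β + (γ + Pi.single i 1) + δ = β + Pi.single i 1 + γ + δ by abel, mlen_add β,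
      mlen_single, pow_succ]
    ring

lemma norm_pderiv_mul_le {A B k : ℝ} (hk : 0 ≤ k) (hs : 0 ≤ s) {f g : Rd d → ℂ}
    (hf : ContDiff ℝ ∞ f) (hg : ContDiff ℝ ∞ g) {x : Rd d}
    (hfA : ∀ γ, ‖pderiv γ f x‖ ≤ A * (k ^ mlen γ * (mfact γ : ℝ) ^ s))
    (hgB : ∀ δ, ‖pderiv δ g x‖ ≤ B * (k ^ mlen δ * (mfact δ : ℝ) ^ s)) (β : Fin d → ℕ) :
    ‖pderiv β (f * g) x‖ ≤ A * B * ((2 * k) ^ mlen β * (mfact β : ℝ) ^ s) := by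
  have := norm_pderiv_mul_pderiv_le hk hs hf hg hfA hgB β 0 0
  rw [pderiv_zero, pderiv_zero, add_zero, add_zero] at this
  exact this.trans_eq (by rw [mul_pow]; ring)

/-! ### Factorials, powers and exponentials -/

lemma norm_rpow_le_two_rpow_mul {V : Type*} [NormedAddCommGroup V] {p : ℝ} (hp : 0 ≤ p) (x y : V) :
    ‖x‖ ^ p ≤ 2 ^ p * (‖y‖ ^ p + ‖x - y‖ ^ p) := by
  have hmax : ‖x‖ ≤ 2 * max ‖y‖ ‖x - y‖ := by
    rw [two_mul]
    exact (norm_le_norm_add_norm_sub' x y).trans (add_le_add (le_max_left _ _) (le_max_right _ _))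
  calc ‖x‖ ^ p ≤ (2 * max ‖y‖ ‖x - y‖) ^ p := Real.rpow_le_rpow (norm_nonneg x) hmax hp
    _ = 2 ^ p * max ‖y‖ ‖x - y‖ ^ p := Real.mul_rpow zero_le_two (by positivity)
    _ = 2 ^ p * max (‖y‖ ^ p) (‖x - y‖ ^ p) := by
      rw [(Real.monotoneOn_rpow_Ici_of_exponent_nonneg hp).map_max (norm_nonneg _) (norm_nonneg _)]
    _ ≤ 2 ^ p * (‖y‖ ^ p + ‖x - y‖ ^ p) := by
      gcongr
      exact max_le_add_of_nonneg (by positivity) (by positivity)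

lemma rpow_one_div_pow_rpow {X τ : ℝ} (hX : 0 ≤ X) (hτ : τ ≠ 0) (n : ℕ) :
    ((X ^ (1 / τ)) ^ n) ^ τ = X ^ n := by
  rw [← Real.rpow_pow_comm (by positivity), ← Real.rpow_mul hX, one_div_mul_cancel hτ,
    Real.rpow_one]

lemma pow_le_exp_mul_factorial_rpow {X h τ : ℝ} (hX : 0 ≤ X) (hh : 0 < h) (hτ : 0 < τ) (n : ℕ) :
    X ^ n ≤ Real.exp (τ * (X / h) ^ (1 / τ)) * (h ^ n * (n.factorial : ℝ) ^ τ) := by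
  have hX' : 0 ≤ X / h := by positivity
  have hexp : ((X / h) ^ (1 / τ)) ^ n ≤ Real.exp ((X / h) ^ (1 / τ)) * n.factorial :=
    (div_le_iff₀ (by positivity)).1 (Real.pow_div_factorial_le_exp _ (by positivity) n)
  have hpow := Real.rpow_le_rpow (by positivity) hexp hτ.le
  rw [rpow_one_div_pow_rpow hX' hτ.ne', Real.mul_rpow (by positivity) (by positivity),
    ← Real.exp_mul, mul_comm _ τ, div_pow, div_le_iff₀ (by positivity)] at hpow
  linarith

lemma le_two_mul_exp_neg_of_forall_pow_mul_le {Y A B : ℝ}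
    (h : ∀ n : ℕ, Y ^ n * B ≤ A * n.factorial) : B ≤ 2 * A * Real.exp (-(Y / 2)) := by
  have hterm (n : ℕ) : (Y / 2) ^ n / n.factorial * B ≤ (1 / 2) ^ n * A := by
    calc (Y / 2) ^ n / n.factorial * B = (1 / 2) ^ n * (Y ^ n * B / n.factorial) := by
          rw [div_pow, div_pow]; ring
      _ ≤ (1 / 2) ^ n * A := by
          gcongr
          exact (div_le_iff₀ (by positivity)).2 (h n)
  have hsum := (NormedSpace.expSeries_div_hasSum_exp (Y / 2)).mul_right B
  rw [← Real.exp_eq_exp_ℝ] at hsum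
  rw [Real.exp_neg, ← div_eq_mul_inv, le_div_iff₀ (Real.exp_pos _), mul_comm]
  exact hasSum_le hterm hsum (hasSum_geometric_two.mul_right A)

lemma le_exp_neg_of_forall_pow_mul_le {a τ X A B : ℝ} (ha : 0 < a) (hτ : 0 < τ) (hX : 0 ≤ X)
    (hA : 0 ≤ A) (hB : 0 ≤ B)
    (h : ∀ n : ℕ, X ^ n * B ≤ A * (((τ / (2 * a)) ^ τ) ^ n * (n.factorial : ℝ) ^ τ)) :
    B ≤ 2 ^ τ * A * Real.exp (-(a * X ^ (1 / τ))) := by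
  have hroot {C : ℝ} (hC : 0 ≤ C) : (C ^ (1 / τ)) ^ τ = C := by
    simpa using rpow_one_div_pow_rpow hC hτ.ne' 1
  have hle : B ^ (1 / τ) ≤ 2 * A ^ (1 / τ) * Real.exp (-(2 * a / τ * X ^ (1 / τ) / 2)) := by
    refine le_two_mul_exp_neg_of_forall_pow_mul_le fun n => ?_
    refine (Real.rpow_le_rpow_iff (by positivity) (by positivity) hτ).1 ?_
    rw [Real.mul_rpow (by positivity) (by positivity), Real.mul_rpow (by positivity)
      (by positivity), hroot hA, hroot hB, mul_pow, Real.mul_rpow (by positivity) (by positivity),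
      rpow_one_div_pow_rpow hX hτ.ne', ← Real.rpow_pow_comm (by positivity), mul_assoc]
    calc ((2 * a / τ) ^ τ) ^ n * (X ^ n * B)
      _ ≤ ((2 * a / τ) ^ τ) ^ n * (A * (((τ / (2 * a)) ^ τ) ^ n * (n.factorial : ℝ) ^ τ)) :=
        mul_le_mul_of_nonneg_left (h n) (by positivity)
      _ = ((2 * a / τ * (τ / (2 * a))) ^ τ) ^ n * (A * (n.factorial : ℝ) ^ τ) := by
        rw [Real.mul_rpow (by positivity) (by positivity)]
        ring
      _ = A * (n.factorial : ℝ) ^ τ := by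
        rw [div_mul_div_cancel₀ hτ.ne', div_self (by positivity), Real.one_rpow, one_pow, one_mul]
  have hpow := Real.rpow_le_rpow (by positivity) hle hτ.le
  rw [hroot hB, Real.mul_rpow (by positivity) (by positivity), Real.mul_rpow zero_le_two
    (by positivity), hroot hA, ← Real.exp_mul] at hpow
  refine hpow.trans_eq ?_
  congr 2
  field_simp

lemma exists_abs_monom_le {h τ : ℝ} (hτ : 0 < τ) (hh : 0 < h) : ∃ a : ℝ, 0 < a ∧
    ∀ (α : Fin d → ℕ) (x : Rd d), |monom α x| ≤
      Real.exp (a * ‖x‖ ^ (1 / τ)) * (h ^ mlen α * (mfact α : ℝ) ^ τ) := by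
  refine ⟨(d + 1) * (τ * (1 / h) ^ (1 / τ)), by positivity, fun α x => ?_⟩
  have hcoord (i : Fin d) : |x i| ^ α i ≤ Real.exp (τ * (1 / h) ^ (1 / τ) * ‖x‖ ^ (1 / τ)) *
      (h ^ α i * ((α i).factorial : ℝ) ^ τ) := by
    refine (pow_le_pow_left₀ (abs_nonneg _) (PiLp.norm_apply_le x i) _).trans
      ((pow_le_exp_mul_factorial_rpow (norm_nonneg x) hh hτ _).trans_eq ?_)
    rw [div_eq_mul_one_div, Real.mul_rpow (by positivity) (by positivity)]
    ring_nf
  calc |monom α x| = ∏ i, |x i| ^ α i := by simp only [monom, Finset.abs_prod, abs_pow]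
    _ ≤ ∏ i, Real.exp (τ * (1 / h) ^ (1 / τ) * ‖x‖ ^ (1 / τ)) *
        (h ^ α i * ((α i).factorial : ℝ) ^ τ) :=
      Finset.prod_le_prod (fun _ _ => by positivity) fun i _ => hcoord i
    _ = Real.exp (d * (τ * (1 / h) ^ (1 / τ)) * ‖x‖ ^ (1 / τ)) *
        (h ^ mlen α * (mfact α : ℝ) ^ τ) := by
      rw [Finset.prod_mul_distrib, Finset.prod_mul_distrib, Finset.prod_const, Finset.card_fin,
        ← Real.exp_nat_mul, Finset.prod_pow_eq_pow_sum, ← mul_assoc (d : ℝ),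
        Real.finsetProd_rpow _ _ fun _ _ => by positivity, mlen, mfact, Nat.cast_prod]
    _ ≤ _ := by
      gcongr
      linarith

lemma exists_norm_le_sqrt_mul_abs_coord [Nonempty (Fin d)] (x : Rd d) :
    ∃ j, ‖x‖ ≤ √d * |x j| := by
  obtain ⟨j, hj⟩ := Finite.exists_max fun i => |x i|
  refine ⟨j, ?_⟩
  have := (EuclideanSpace.basisFun (Fin d) ℝ).norm_le_card_mul_iSup_norm_inner x
  rw [Fintype.card_fin] at this
  refine this.trans (mul_le_mul_of_nonneg_left (ciSup_le fun i => ?_) (by positivity))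
  simpa [EuclideanSpace.inner_single_left] using hj i

lemma exists_le_exp_neg_of_forall_abs_monom_mul_le {a τ : ℝ} (ha : 0 < a) (hτ : 0 < τ) :
    ∃ h : ℝ, 0 < h ∧ ∀ (A B : ℝ) (x : Rd d), 0 ≤ B →
      (∀ α, |monom α x| * B ≤ A * (h ^ mlen α * (mfact α : ℝ) ^ τ)) →
      B ≤ 2 ^ τ * A * Real.exp (-(a * ‖x‖ ^ (1 / τ))) := by
  refine ⟨(τ / (2 * a)) ^ τ / (√d + 1), by positivity, fun A B x hB h => ?_⟩
  have hBA : B ≤ A := by simpa [monom_zero, mlen_zero, mfact_zero] using h 0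
  refine le_exp_neg_of_forall_pow_mul_le ha hτ (norm_nonneg x) (hB.trans hBA) hB fun n => ?_
  rcases isEmpty_or_nonempty (Fin d) with hd | hd
  · rcases n with _ | n
    · simpa using hBA
    · have hA := hB.trans hBA
      rw [Subsingleton.elim x 0, norm_zero, zero_pow n.succ_ne_zero, zero_mul]
      positivity
  obtain ⟨j, hj⟩ := exists_norm_le_sqrt_mul_abs_coord x
  have hx : ‖x‖ ≤ (√d + 1) * |x j| := hj.trans (by gcongr; linarith)
  have hmonom := h (Pi.single j n)
  rw [monom_single, mlen_single, mfact_single, abs_pow] at hmonom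
  calc ‖x‖ ^ n * B ≤ ((√d + 1) * |x j|) ^ n * B := by gcongr
    _ = (√d + 1) ^ n * (|x j| ^ n * B) := by rw [mul_pow, mul_assoc]
    _ ≤ (√d + 1) ^ n * (A * (((τ / (2 * a)) ^ τ / (√d + 1)) ^ n * (n.factorial : ℝ) ^ τ)) := by
      gcongr
    _ = _ := by
      rw [div_pow]
      field_simp

lemma integrable_exp_neg_mul_norm_rpow {a p : ℝ} (ha : 0 < a) (hp : 0 < p) :
    Integrable (fun x : Rd d => Real.exp (-(a * ‖x‖ ^ p))) := by
  rcases subsingleton_or_nontrivial (Rd d) with hd | hd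
  · exact Integrable.of_subsingleton
  refine (integrable_fun_norm_addHaar volume (f := fun r => Real.exp (-(a * r ^ p)))).2 ?_
  have := integrableOn_rpow_mul_exp_neg_mul_rpow (p := p) (b := a)
    (s := (Module.finrank ℝ (Rd d) - 1 : ℕ)) (neg_one_lt_zero.trans_le (Nat.cast_nonneg _)) hp ha
  simpa only [Real.rpow_natCast, smul_eq_mul, neg_mul] using this

/-- The function `|x|^{1/t} + |ξ|^{1/s}` on phase space. -/
def phaseWeight (t s : ℝ) (z : Rd d × Rd d) : ℝ := ‖z.1‖ ^ (1 / t) + ‖z.2‖ ^ (1 / s)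

lemma continuous_phaseWeight (ht : 0 < t) (hs : 0 < s) :
    Continuous (phaseWeight t s : Rd d × Rd d → ℝ) :=
  (continuous_fst.norm.rpow_const fun _ => Or.inr (one_div_pos.2 ht).le).add
    (continuous_snd.norm.rpow_const fun _ => Or.inr (one_div_pos.2 hs).le)

lemma integrable_exp_neg_mul_phaseWeight (ht : 0 < t) (hs : 0 < s) {a : ℝ} (ha : 0 < a) :
    Integrable (fun z : Rd d × Rd d => Real.exp (-(a * phaseWeight t s z))) := by
  have := (integrable_exp_neg_mul_norm_rpow (d := d) ha (one_div_pos.2 ht)).mul_prod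
    (integrable_exp_neg_mul_norm_rpow (d := d) ha (one_div_pos.2 hs))
  simpa only [phaseWeight, mul_add, neg_add, Real.exp_add, Measure.volume_eq_prod] using this

/-! ### Gabor atoms -/

/-- Derivatives of Gevrey order `s` with exponential decay of order `1 / t`:
`|∂^β f(y)| ≤ A k^{|β|} β!^s e^{-a |y|^{1/t}}`. A smooth function lies in `Σ_t^s(ℝ^d)` iff it
satisfies such bounds for all `a, k > 0`. -/
structure HasGSDecay (t s A a k : ℝ) (f : Rd d → ℂ) : Prop where
  contDiff : ContDiff ℝ ∞ f
  norm_pderiv_le : ∀ β y, ‖pderiv β f y‖ ≤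
    A * Real.exp (-(a * ‖y‖ ^ (1 / t))) * (k ^ mlen β * (mfact β : ℝ) ^ s)

namespace HasGSDecay

variable {A a k : ℝ} {f : Rd d → ℂ}

lemma norm_le (hf : HasGSDecay t s A a k f) (y : Rd d) :
    ‖f y‖ ≤ A * Real.exp (-(a * ‖y‖ ^ (1 / t))) := by
  simpa [pderiv_zero, mlen_zero, mfact_zero] using hf.norm_pderiv_le 0 y

lemma nonneg (hf : HasGSDecay t s A a k f) : 0 ≤ A :=
  nonneg_of_mul_nonneg_left ((norm_nonneg _).trans (hf.norm_le 0)) (Real.exp_pos _)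

lemma norm_le_const (hf : HasGSDecay t s A a k f) (ha : 0 ≤ a) (y : Rd d) : ‖f y‖ ≤ A := by
  refine (hf.norm_le y).trans (mul_le_of_le_one_right hf.nonneg (Real.exp_le_one_iff.2 ?_))
  exact neg_nonpos.2 (by positivity)

lemma integrable_pderiv (hf : HasGSDecay t s A a k f) (ht : 0 < t) (ha : 0 < a)
    (β : Fin d → ℕ) : Integrable (pderiv β f) :=
  (((integrable_exp_neg_mul_norm_rpow ha (one_div_pos.2 ht)).const_mul A).mul_const _).mono'
    (contDiff_pderiv hf.contDiff β).continuous.aestronglyMeasurable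
    (.of_forall (hf.norm_pderiv_le β))

lemma integrable (hf : HasGSDecay t s A a k f) (ht : 0 < t) (ha : 0 < a) : Integrable f := by
  simpa only [pderiv_zero] using hf.integrable_pderiv ht ha 0

lemma integral_norm_pderiv_le (hf : HasGSDecay t s A a k f) (ht : 0 < t) (ha : 0 < a)
    (β : Fin d → ℕ) : ∫ y, ‖pderiv β f y‖ ≤
      A * (∫ y : Rd d, Real.exp (-(a * ‖y‖ ^ (1 / t)))) * (k ^ mlen β * (mfact β : ℝ) ^ s) := by
  have hint := integrable_exp_neg_mul_norm_rpow (d := d) ha (one_div_pos.2 ht)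
  rw [← integral_const_mul, ← integral_mul_const]
  exact integral_mono (hf.integrable_pderiv ht ha β).norm ((hint.const_mul A).mul_const _)
    (hf.norm_pderiv_le β)

end HasGSDecay

lemma GelfandShilov.exists_hasGSDecay (ht : 0 < t) (φ : GelfandShilov d t s) {a k : ℝ}
    (ha : 0 < a) (hk : 0 < k) : ∃ A, HasGSDecay t s A a k φ := by
  obtain ⟨h, hh, hmonom⟩ := exists_le_exp_neg_of_forall_abs_monom_mul_le (d := d) ha ht
  obtain ⟨C, hC, hφ⟩ := (isGS_iff.1 φ.2).2 (min h k) (lt_min hh hk)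
  refine ⟨2 ^ t * C, φ.2.1, fun β y => ?_⟩
  refine (hmonom (C * (k ^ mlen β * (mfact β : ℝ) ^ s)) _ y (norm_nonneg _) fun α => ?_).trans_eq
    (by ring)
  calc |monom α y| * ‖pderiv β φ y‖
    _ ≤ C * (min h k ^ (mlen α + mlen β) * (mfact α : ℝ) ^ t * (mfact β : ℝ) ^ s) := hφ α β y
    _ ≤ C * (h ^ mlen α * k ^ mlen β * (mfact α : ℝ) ^ t * (mfact β : ℝ) ^ s) := by
      rw [pow_add]
      gcongr
      · exact min_le_left h k
      · exact min_le_right h k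
    _ = _ := by ring

/-- The plane wave `y ↦ e^{i⟨y, ξ⟩}`. -/
def planeWave (ξ : Rd d) (y : Rd d) : ℂ := Complex.exp (Complex.I * (inner ℝ y ξ : ℝ))

lemma norm_planeWave (ξ y : Rd d) : ‖planeWave ξ y‖ = 1 := by
  rw [planeWave, mul_comm, Complex.norm_exp_ofReal_mul_I]

lemma contDiff_planeWave : ContDiff ℝ ∞ fun p : Rd d × Rd d => planeWave p.1 p.2 :=
  (contDiff_const.mul (Complex.ofRealCLM.contDiff.comp (contDiff_snd.inner ℝ contDiff_fst))).cexp

lemma contDiff_planeWave_right (ξ : Rd d) : ContDiff ℝ ∞ (planeWave ξ) :=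
  contDiff_planeWave.comp (contDiff_const.prodMk contDiff_id)

lemma pd_planeWave (i : Fin d) (ξ : Rd d) :
    pd i (planeWave ξ) = (Complex.I * (ξ i : ℂ)) • planeWave ξ := by
  funext y
  have hinner : HasFDerivAt (fun y : Rd d => ((inner ℝ y ξ : ℝ) : ℂ))
      (Complex.ofRealCLM ∘L innerSL ℝ ξ) y := by
    simpa only [innerSL_apply_apply, real_inner_comm] using!
      (Complex.ofRealCLM ∘L innerSL ℝ ξ).hasFDerivAt (x := y)
  have hexp := (hinner.const_mul Complex.I).cexp
  rw [pd, show planeWave ξ = fun y => Complex.exp (Complex.I * (inner ℝ y ξ : ℝ)) from rfl,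
    hexp.fderiv]
  simp [EuclideanSpace.inner_single_right, mul_comm]

lemma pderiv_planeWave (β : Fin d → ℕ) (ξ : Rd d) :
    pderiv β (planeWave ξ) = (Complex.I ^ mlen β * (monom β ξ : ℂ)) • planeWave ξ := by
  induction β using multiIndex_induction with
  | zero => simp [pderiv_zero, mlen_zero, monom_zero]
  | add_single β i ih =>
    have hξ := contDiff_planeWave_right ξ
    rw [pderiv_add_single β i hξ, ih, pd_smul _ hξ, pd_planeWave, smul_smul, mlen_add,
      mlen_single, monom_add, monom_single, pow_one, pow_succ, Complex.ofReal_mul]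
    congr 1
    ring

lemma norm_pderiv_planeWave (β : Fin d → ℕ) (ξ y : Rd d) :
    ‖pderiv β (planeWave ξ) y‖ = |monom β ξ| := by
  simp [pderiv_planeWave, norm_planeWave]

/-- The Gabor atom `M_ξ T_x ψ` of a function `ψ` at the phase space point `z = (x, ξ)`; for
`ψ ∈ Σ_t^s(ℝ^d)` this is the function underlying `tfShift`. -/
def gaborAtom (ψ : Rd d → ℂ) (z : Rd d × Rd d) : Rd d → ℂ := modulate z.2 (translate z.1 ψ)

lemma gaborAtom_eq_mul (ψ : Rd d → ℂ) (z : Rd d × Rd d) :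
    gaborAtom ψ z = planeWave z.2 * translate z.1 ψ := rfl

lemma norm_gaborAtom (ψ : Rd d → ℂ) (z : Rd d × Rd d) (y : Rd d) :
    ‖gaborAtom ψ z y‖ = ‖ψ (y - z.1)‖ := by
  rw [gaborAtom_eq_mul, Pi.mul_apply, norm_mul, norm_planeWave, one_mul, translate]

lemma contDiff_gaborAtom_uncurry {ψ : Rd d → ℂ} (hψ : ContDiff ℝ ∞ ψ) :
    ContDiff ℝ ∞ fun p : (Rd d × Rd d) × Rd d => gaborAtom ψ p.1 p.2 :=
  (contDiff_planeWave.comp (contDiff_fst.snd.prodMk contDiff_snd)).mul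
    (hψ.comp (contDiff_snd.sub contDiff_fst.fst))

lemma contDiff_gaborAtom {ψ : Rd d → ℂ} (hψ : ContDiff ℝ ∞ ψ) (z : Rd d × Rd d) :
    ContDiff ℝ ∞ (gaborAtom ψ z) :=
  (contDiff_planeWave_right _).mul (contDiff_translate _ hψ)

lemma exists_norm_pderiv_gaborAtom_le (hs : 0 < s) {k : ℝ} (hk : 0 < k) :
    ∃ c : ℝ, 0 < c ∧ ∀ {A a : ℝ} {ψ : Rd d → ℂ}, HasGSDecay t s A a k ψ → ∀ β z y,
      ‖pderiv β (gaborAtom ψ z) y‖ ≤ Real.exp (c * ‖z.2‖ ^ (1 / s)) *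
        (A * Real.exp (-(a * ‖y - z.1‖ ^ (1 / t)))) * ((2 * k) ^ mlen β * (mfact β : ℝ) ^ s) := by
  obtain ⟨c, hc, hmonom⟩ := exists_abs_monom_le (d := d) hs hk
  refine ⟨c, hc, fun hψ β z y => norm_pderiv_mul_le hk.le hs.le (contDiff_planeWave_right z.2)
    (contDiff_translate z.1 hψ.contDiff) (fun γ => ?_) (fun δ => ?_) β⟩
  · exact (norm_pderiv_planeWave γ z.2 y).trans_le (hmonom γ z.2)
  · rw [pderiv_translate]
    exact hψ.norm_pderiv_le δ (y - z.1)

lemma GelfandShilov.exists_hasGSDecay_gaborAtom (ht : 0 < t) (hs : 0 < s)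
    (ψ : GelfandShilov d t s) {a k : ℝ} (ha : 0 < a) (hk : 0 < k) :
    ∃ C r : ℝ, 0 ≤ C ∧ 0 ≤ r ∧
      ∀ z, HasGSDecay t s (C * Real.exp (r * phaseWeight t s z)) a k (gaborAtom ψ z) := by
  set b : ℝ := a * 2 ^ (1 / t)
  have hb : 0 < b := by positivity
  obtain ⟨c, -, hatom⟩ := exists_norm_pderiv_gaborAtom_le (d := d) (t := t) hs (half_pos hk)
  obtain ⟨A, hψ⟩ := ψ.exists_hasGSDecay ht hb (half_pos hk)
  have hA := hψ.nonneg
  refine ⟨A, max b c, hA, hb.le.trans (le_max_left b c), fun z =>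
    ⟨contDiff_gaborAtom ψ.2.1 z, fun β y => (hatom hψ β z y).trans ?_⟩⟩
  have hnorm : a * ‖y‖ ^ (1 / t) ≤ b * ‖z.1‖ ^ (1 / t) + b * ‖y - z.1‖ ^ (1 / t) := by
    rw [← mul_add, mul_assoc]
    gcongr
    exact norm_rpow_le_two_rpow_mul (one_div_pos.2 ht).le y z.1
  have hweight : b * ‖z.1‖ ^ (1 / t) + c * ‖z.2‖ ^ (1 / s) ≤ max b c * phaseWeight t s z := by
    rw [phaseWeight, mul_add]
    gcongr
    · exact le_max_left b c
    · exact le_max_right b c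
  rw [mul_div_cancel₀ k two_ne_zero, mul_left_comm (Real.exp _) A, ← Real.exp_add,
    mul_assoc A (Real.exp (max b c * _)), ← Real.exp_add]
  gcongr A * Real.exp ?_ * _
  linarith

/-! ### The Gabor transform and its inversion -/

lemma conj_planeWave (ξ y : Rd d) : starRingEnd ℂ (planeWave ξ y) = planeWave (-ξ) y := by
  simp [planeWave, ← Complex.exp_conj]

lemma integrable_planeWave_mul (ξ : Rd d) {g : Rd d → ℂ} (hg : Integrable g) :
    Integrable (planeWave ξ * g) :=
  hg.bdd_mul (c := 1) (contDiff_planeWave_right ξ).continuous.aestronglyMeasurable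
    (.of_forall fun y => (norm_planeWave ξ y).le)

lemma integral_planeWave_mul_pd (ξ : Rd d) (i : Fin d) {g : Rd d → ℂ} (hg : ContDiff ℝ ∞ g)
    (hint : Integrable g) (hpd : Integrable (pd i g)) :
    ∫ y, planeWave ξ y * pd i g y = -(Complex.I * ξ i * ∫ y, planeWave ξ y * g y) := by
  have hmul := integrable_planeWave_mul ξ hint
  have hderiv (y : Rd d) : fderiv ℝ (planeWave ξ) y (EuclideanSpace.single i 1) * g y =
      Complex.I * ξ i * (planeWave ξ y * g y) := by
    rw [← mul_assoc]
    exact congrArg (· * g y) (congrFun (pd_planeWave i ξ) y)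
  have hparts := integral_mul_fderiv_eq_neg_fderiv_mul_of_integrable (μ := volume)
    (f := planeWave ξ) (g := g) (v := EuclideanSpace.single i (1 : ℝ))
    ((hmul.const_mul _).congr (.of_forall fun y => (hderiv y).symm))
    (integrable_planeWave_mul ξ hpd) hmul
    (fun y _ => (contDiff_planeWave_right ξ).differentiable (by simp) y)
    (fun y _ => hg.differentiable (by simp) y)
  simp only [hderiv, integral_const_mul] at hparts
  exact hparts

lemma abs_monom_mul_norm_integral_planeWave_le (ξ : Rd d) {g : Rd d → ℂ} (hg : ContDiff ℝ ∞ g)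
    (hint : ∀ β, Integrable (pderiv β g)) (β : Fin d → ℕ) :
    |monom β ξ| * ‖∫ y, planeWave ξ y * g y‖ ≤ ∫ y, ‖pderiv β g y‖ := by
  have heq : ‖∫ y, planeWave ξ y * pderiv β g y‖ =
      |monom β ξ| * ‖∫ y, planeWave ξ y * g y‖ := by
    induction β using multiIndex_induction with
    | zero => simp [pderiv_zero, monom_zero]
    | add_single β i ih =>
      have hpd := pderiv_add_single β i hg
      rw [hpd, integral_planeWave_mul_pd ξ i (contDiff_pderiv hg β) (hint β) (hpd ▸ hint _),
        norm_neg, norm_mul, ih, norm_mul, Complex.norm_I, Complex.norm_real, monom_add,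
        monom_single, abs_mul, pow_one, Real.norm_eq_abs, one_mul]
      ring
  rw [← heq]
  refine (norm_integral_le_integral_norm _).trans_eq ?_
  simp only [norm_mul, norm_planeWave, one_mul]

lemma fourier_inv_two_pi_smul (g : Rd d → ℂ) (ξ : Rd d) :
    𝓕 g ((2 * Real.pi)⁻¹ • ξ) = ∫ y, planeWave (-ξ) y * g y := by
  rw [Real.fourier_eq']
  congr 1
  funext y
  rw [smul_eq_mul, planeWave, inner_smul_right, inner_neg_right, neg_mul, neg_mul,
    mul_inv_cancel_left₀ Real.two_pi_pos.ne', mul_comm Complex.I]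

lemma integral_fourier_mul_planeWave {g : Rd d → ℂ} (hg : Continuous g) (hint : Integrable g)
    (hfourier : Integrable (𝓕 g)) (y : Rd d) :
    ∫ ξ, 𝓕 g ((2 * Real.pi)⁻¹ • ξ) * planeWave ξ y = ((2 * Real.pi) ^ d : ℝ) * g y := by
  have hinv := hint.fourierInv_fourier_eq hfourier (hg.continuousAt (x := y))
  rw [Real.fourierInv_eq'] at hinv
  have hcomp := Measure.integral_comp_smul (volume : Measure (Rd d)) (fun ξ =>
    Complex.exp (↑(2 * Real.pi * inner ℝ ξ y) * Complex.I) • 𝓕 g ξ) (2 * Real.pi)⁻¹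
  rw [hinv, finrank_euclideanSpace_fin, inv_pow, inv_inv, abs_of_pos (by positivity),
    Complex.real_smul] at hcomp
  rw [← hcomp]
  congr 1
  funext ξ
  rw [smul_eq_mul, mul_comm, planeWave, real_inner_smul_left, real_inner_comm,
    mul_inv_cancel_left₀ Real.two_pi_pos.ne', mul_comm Complex.I]

/-- The Gabor transform of `φ` with window `ψ`, without the normalising factor `(2π)^{-d/2}`. -/
def gabor (ψ φ : Rd d → ℂ) (z : Rd d × Rd d) : ℂ := ∫ y, φ y * starRingEnd ℂ (gaborAtom ψ z y)

/-- The product of `φ` with the conjugate of `T_x ψ`; its Fourier transform is the Gabor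
transform of `φ` at the points over `x`. -/
def windowed (ψ φ : Rd d → ℂ) (x : Rd d) : Rd d → ℂ :=
  φ * fun y => starRingEnd ℂ (translate x ψ y)

lemma gabor_eq_integral_planeWave (ψ φ : Rd d → ℂ) (z : Rd d × Rd d) :
    gabor ψ φ z = ∫ y, planeWave (-z.2) y * windowed ψ φ z.1 y := by
  simp only [gabor, gaborAtom_eq_mul, windowed, Pi.mul_apply, map_mul, conj_planeWave,
    mul_left_comm]

lemma gabor_eq_fourier (ψ φ : Rd d → ℂ) (z : Rd d × Rd d) :
    gabor ψ φ z = 𝓕 (windowed ψ φ z.1) ((2 * Real.pi)⁻¹ • z.2) := by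
  rw [gabor_eq_integral_planeWave, fourier_inv_two_pi_smul]

lemma HasGSDecay.windowed (ht : 0 < t) (hs : 0 ≤ s) {A B a k : ℝ} {ψ φ : Rd d → ℂ} (ha : 0 ≤ a)
    (hk : 0 ≤ k) (hψ : HasGSDecay t s B (a * 2 ^ (1 / t) + 1) k ψ)
    (hφ : HasGSDecay t s A (a * 2 ^ (1 / t) + 1) k φ) (x : Rd d) :
    HasGSDecay t s (A * B * Real.exp (-(a * ‖x‖ ^ (1 / t)))) 1 (2 * k) (windowed ψ φ x) := by
  have hψx := contDiff_translate x hψ.contDiff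
  refine ⟨hφ.contDiff.mul (contDiff_conj hψx), fun β y => ?_⟩
  refine (norm_pderiv_mul_le hk hs hφ.contDiff (contDiff_conj hψx)
    (fun γ => hφ.norm_pderiv_le γ y) (B := B * Real.exp (-((a * 2 ^ (1 / t) + 1) *
    ‖y - x‖ ^ (1 / t)))) (fun δ => ?_) β).trans ?_
  · rw [pderiv_conj δ hψx, RCLike.norm_conj, pderiv_translate]
    exact hψ.norm_pderiv_le δ (y - x)
  have hA := hφ.nonneg
  have hB := hψ.nonneg
  have hnorm : a * ‖x‖ ^ (1 / t) ≤ a * (2 ^ (1 / t) * (‖y‖ ^ (1 / t) + ‖y - x‖ ^ (1 / t))) := by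
    rw [norm_sub_rev y x]
    gcongr
    exact norm_rpow_le_two_rpow_mul (one_div_pos.2 ht).le x y
  have hyx : 0 ≤ ‖y - x‖ ^ (1 / t) := by positivity
  rw [mul_mul_mul_comm A (Real.exp _) B, ← Real.exp_add,
    mul_assoc (A * B) (Real.exp (-(a * _))), ← Real.exp_add]
  gcongr A * B * Real.exp ?_ * _
  linarith

lemma GelfandShilov.exists_norm_gabor_le (ht : 0 < t) (hs : 0 < s) (ψ φ : GelfandShilov d t s)
    {a : ℝ} (ha : 0 < a) :
    ∃ C, 0 ≤ C ∧ ∀ z, ‖gabor ψ φ z‖ ≤ C * Real.exp (-(a * phaseWeight t s z)) := by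
  obtain ⟨h, hh, hmonom⟩ := exists_le_exp_neg_of_forall_abs_monom_mul_le (d := d) ha hs
  have ha' : 0 < a * 2 ^ (1 / t) + 1 := by positivity
  obtain ⟨A, hφ⟩ := φ.exists_hasGSDecay ht ha' (half_pos hh)
  obtain ⟨B, hψ⟩ := ψ.exists_hasGSDecay ht ha' (half_pos hh)
  have hA := hφ.nonneg
  have hB := hψ.nonneg
  set K : ℝ := ∫ y : Rd d, Real.exp (-(1 * ‖y‖ ^ (1 / t)))
  have hK : 0 ≤ K := integral_nonneg fun y => (Real.exp_pos _).le
  refine ⟨2 ^ s * (A * B * K), by positivity, fun z => ?_⟩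
  have hw := hψ.windowed ht hs.le ha.le (half_pos hh).le hφ z.1
  rw [mul_div_cancel₀ h two_ne_zero] at hw
  have hle := hmonom (A * B * Real.exp (-(a * ‖z.1‖ ^ (1 / t))) * K) ‖gabor ψ φ z‖ (-z.2)
    (norm_nonneg _) fun β => by
      rw [gabor_eq_integral_planeWave]
      exact (abs_monom_mul_norm_integral_planeWave_le (-z.2) hw.contDiff
        (hw.integrable_pderiv ht one_pos) β).trans (hw.integral_norm_pderiv_le ht one_pos β)
  refine hle.trans_eq ?_
  rw [norm_neg, phaseWeight, mul_add, neg_add, Real.exp_add]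
  ring

lemma stronglyMeasurable_gabor {ψ φ : Rd d → ℂ} (hψ : ContDiff ℝ ∞ ψ) (hφ : Continuous φ) :
    StronglyMeasurable (gabor ψ φ) := by
  have : Continuous fun p : (Rd d × Rd d) × Rd d => φ p.2 * starRingEnd ℂ (gaborAtom ψ p.1 p.2) :=
    (hφ.comp continuous_snd).mul
      (Complex.continuous_conj.comp (contDiff_gaborAtom_uncurry hψ).continuous)
  exact this.stronglyMeasurable.integral_prod_right'

lemma GelfandShilov.integrable_gabor (ht : 0 < t) (hs : 0 < s) (ψ φ : GelfandShilov d t s) :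
    Integrable (gabor ψ φ) := by
  obtain ⟨C, -, hle⟩ := ψ.exists_norm_gabor_le ht hs φ one_pos
  exact ((integrable_exp_neg_mul_phaseWeight ht hs one_pos).const_mul C).mono'
    (stronglyMeasurable_gabor ψ.2.1 φ.2.1.continuous).aestronglyMeasurable (.of_forall hle)

/-- The constant `(2π)^d ‖ψ‖²` of the inversion formula for the Gabor transform. -/
def gaborConst (ψ : Rd d → ℂ) : ℝ := (2 * Real.pi) ^ d * ∫ y, ‖ψ y‖ ^ 2

lemma GelfandShilov.gaborConst_pos (ht : 0 < t) {ψ : GelfandShilov d t s} (hψ : ψ ≠ 0) :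
    0 < gaborConst ψ := by
  obtain ⟨A, hA⟩ := ψ.exists_hasGSDecay ht one_pos one_pos
  have hcont : Continuous fun y => ‖ψ.1 y‖ ^ 2 := hA.contDiff.continuous.norm.pow 2
  have hint : Integrable fun y => ‖ψ.1 y‖ ^ 2 := by
    simp only [sq]
    exact (hA.integrable ht one_pos).norm.mul_bdd (c := A)
      hA.contDiff.continuous.norm.aestronglyMeasurable
      (.of_forall fun y => (norm_norm _).trans_le (hA.norm_le_const zero_le_one y))
  obtain ⟨y, hy⟩ : ∃ y, ψ.1 y ≠ 0 := Function.ne_iff.1 (Subtype.coe_ne_coe.2 hψ)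
  exact mul_pos (by positivity) (integral_pos_of_integrable_nonneg_nonzero hcont hint
    (fun y => by positivity) (x := y) (by positivity))

lemma GelfandShilov.integral_gabor_mul_gaborAtom_slice (ht : 0 < t) (hs : 0 < s)
    (ψ φ : GelfandShilov d t s) (x y : Rd d) :
    ∫ ξ, gabor ψ φ (x, ξ) * gaborAtom ψ (x, ξ) y =
      ((2 * Real.pi) ^ d : ℝ) * φ y * (‖ψ (y - x)‖ ^ 2 : ℝ) := by
  obtain ⟨A, hφ⟩ := φ.exists_hasGSDecay ht (a := 1 * 2 ^ (1 / t) + 1) (by positivity) one_pos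
  obtain ⟨B, hψ⟩ := ψ.exists_hasGSDecay ht (a := 1 * 2 ^ (1 / t) + 1) (by positivity) one_pos
  obtain ⟨C, hC, hle⟩ := ψ.exists_norm_gabor_le ht hs φ one_pos
  have hw := hψ.windowed ht hs.le zero_le_one zero_le_one hφ x
  have hslice : Integrable fun ξ => gabor ψ φ (x, ξ) := by
    refine ((integrable_exp_neg_mul_norm_rpow one_pos (one_div_pos.2 hs)).const_mul C).mono'
      ((stronglyMeasurable_gabor hψ.contDiff hφ.contDiff.continuous).comp_measurable
        measurable_prodMk_left).aestronglyMeasurable (.of_forall fun ξ => (hle (x, ξ)).trans ?_)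
    gcongr
    exact le_add_of_nonneg_left (by positivity)
  simp only [gabor_eq_fourier] at hslice
  have hfourier := (integrable_comp_smul_iff volume _ (inv_ne_zero Real.two_pi_pos.ne')).1 hslice
  have hinv := integral_fourier_mul_planeWave hw.contDiff.continuous (hw.integrable ht one_pos)
    hfourier y
  simp only [gabor_eq_fourier, gaborAtom_eq_mul, Pi.mul_apply, ← mul_assoc, integral_mul_const,
    hinv]
  rw [windowed, Pi.mul_apply, translate, mul_assoc, mul_assoc, ← Complex.normSq_eq_conj_mul_self,
    Complex.normSq_eq_norm_sq, ← mul_assoc]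

lemma GelfandShilov.integral_gabor_mul_gaborAtom (ht : 0 < t) (hs : 0 < s)
    (ψ φ : GelfandShilov d t s) (y : Rd d) :
    ∫ z, gabor ψ φ z * gaborAtom ψ z y = (gaborConst ψ : ℂ) * φ y := by
  obtain ⟨B, hψ⟩ := ψ.exists_hasGSDecay ht one_pos one_pos
  have hint : Integrable (fun z => gabor ψ φ z * gaborAtom ψ z y) :=
    (ψ.integrable_gabor ht hs φ).mul_bdd (c := B)
      ((contDiff_gaborAtom_uncurry ψ.2.1).continuous.comp
        (continuous_id.prodMk continuous_const)).aestronglyMeasurable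
      (.of_forall fun z => (norm_gaborAtom ψ z y).trans_le (hψ.norm_le_const zero_le_one _))
  rw [Measure.volume_eq_prod] at hint ⊢
  rw [integral_prod _ hint]
  simp only [ψ.integral_gabor_mul_gaborAtom_slice ht hs φ]
  rw [integral_const_mul, integral_complex_ofReal,
    integral_sub_left_eq_self (fun x => ‖ψ x‖ ^ 2) volume y, gaborConst]
  push_cast
  ring

/-! ### Differentiation under the integral sign -/

lemma contDiff_pderiv_uncurry {Z : Type*} [NormedAddCommGroup Z] [NormedSpace ℝ Z]
    {g : Z → Rd d → ℂ} (hg : ContDiff ℝ ∞ fun p : Z × Rd d => g p.1 p.2) (β : Fin d → ℕ) :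
    ContDiff ℝ ∞ fun p : Z × Rd d => pderiv β (g p.1) p.2 := by
  induction β using multiIndex_induction with
  | zero => simpa only [pderiv_zero] using hg
  | add_single β i ih =>
    have hslice (z : Z) : ContDiff ℝ ∞ (g z) := hg.comp (contDiff_const.prodMk contDiff_id)
    simp only [pderiv_add_single β i (hslice _), pd]
    exact (ContDiff.fderiv (f := fun p : Z × Rd d => pderiv β (g p.1))
      (ih.comp (contDiff_fst.fst.prodMk contDiff_snd)) contDiff_snd (by simp)).clm_apply
        contDiff_const

lemma fderiv_eq_sum_pd (f : Rd d → ℂ) (y : Rd d) :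
    fderiv ℝ f y =
      ∑ i, (EuclideanSpace.proj i : Rd d →L[ℝ] ℝ).smulRight (pd i f y) := by
  refine ContinuousLinearMap.coe_injective
    ((EuclideanSpace.basisFun (Fin d) ℝ).toBasis.ext fun i => ?_)
  simp [pd, apply_ite Complex.ofReal]

lemma norm_fderiv_le_sum_norm_pd (f : Rd d → ℂ) (y : Rd d) :
    ‖fderiv ℝ f y‖ ≤ ∑ i, ‖pd i f y‖ := by
  rw [fderiv_eq_sum_pd]
  refine (norm_sum_le _ _).trans (Finset.sum_le_sum fun i _ => ?_)
  rw [ContinuousLinearMap.norm_smulRight_apply]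
  refine mul_le_of_le_one_left (norm_nonneg _)
    (ContinuousLinearMap.opNorm_le_bound _ zero_le_one fun v => ?_)
  simpa using PiLp.norm_apply_le v i

/-- A measurable family of smooth functions on `ℝ^d` all of whose derivatives are dominated,
locally uniformly, by integrable functions of the parameter, so that its integral can be
differentiated under the integral sign. -/
structure IsDominatedFamily {Z : Type*} [MeasurableSpace Z] (μ : Measure Z) (F : Z → Rd d → ℂ) :
    Prop where
  contDiff : ∀ z, ContDiff ℝ ∞ (F z)
  aestronglyMeasurable : ∀ β y, AEStronglyMeasurable (fun z => pderiv β (F z) y) μ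
  exists_bound : ∀ (β : Fin d → ℕ) (ρ : ℝ), ∃ b : Z → ℝ, Integrable b μ ∧
    ∀ z y, ‖y‖ ≤ ρ → ‖pderiv β (F z) y‖ ≤ b z

namespace IsDominatedFamily

variable {Z : Type*} [MeasurableSpace Z] {μ : Measure Z} {F : Z → Rd d → ℂ}

lemma pd (h : IsDominatedFamily μ F) (i : Fin d) :
    IsDominatedFamily μ fun z => GS.pd i (F z) where
  contDiff z := contDiff_pd (h.contDiff z) i
  aestronglyMeasurable β y := by
    simpa only [pderiv_pd β i (h.contDiff _)] using h.aestronglyMeasurable (β + Pi.single i 1) y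
  exists_bound β ρ := by
    simpa only [pderiv_pd β i (h.contDiff _)] using h.exists_bound (β + Pi.single i 1) ρ

lemma integrable (h : IsDominatedFamily μ F) (y : Rd d) : Integrable (fun z => F z y) μ := by
  obtain ⟨b, hb, hle⟩ := h.exists_bound 0 ‖y‖
  have hmeas := h.aestronglyMeasurable 0 y
  simp only [pderiv_zero] at hle hmeas
  exact hb.mono' hmeas (.of_forall fun z => hle z y le_rfl)

lemma aestronglyMeasurable_fderiv (h : IsDominatedFamily μ F) (y : Rd d) :
    AEStronglyMeasurable (fun z => fderiv ℝ (F z) y) μ := by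
  simp only [fderiv_eq_sum_pd]
  refine Finset.aestronglyMeasurable_fun_sum _ fun i _ => ?_
  exact (ContinuousLinearMap.smulRightL ℝ (Rd d) ℂ (EuclideanSpace.proj i)).continuous
    |>.comp_aestronglyMeasurable ((h.pd i).integrable y).aestronglyMeasurable

lemma exists_norm_fderiv_le (h : IsDominatedFamily μ F) (ρ : ℝ) :
    ∃ b : Z → ℝ, Integrable b μ ∧ ∀ z y, ‖y‖ ≤ ρ → ‖fderiv ℝ (F z) y‖ ≤ b z := by
  choose b hb hle using fun i => (h.pd i).exists_bound 0 ρ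
  refine ⟨fun z => ∑ i, b i z, integrable_finsetSum _ fun i _ => hb i, fun z y hy => ?_⟩
  refine (norm_fderiv_le_sum_norm_pd (F z) y).trans (Finset.sum_le_sum fun i _ => ?_)
  simpa only [pderiv_zero] using hle i z y hy

lemma hasFDerivAt_integral (h : IsDominatedFamily μ F) (y : Rd d) :
    HasFDerivAt (fun y => ∫ z, F z y ∂μ) (∫ z, fderiv ℝ (F z) y ∂μ) y := by
  obtain ⟨b, hb, hle⟩ := h.exists_norm_fderiv_le (‖y‖ + 1)
  refine hasFDerivAt_integral_of_dominated_of_fderiv_le (Metric.ball_mem_nhds y one_pos)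
    (.of_forall fun y => (h.integrable y).aestronglyMeasurable) (h.integrable y)
    (h.aestronglyMeasurable_fderiv y) (.of_forall fun z x hx => hle z x ?_) hb
    (.of_forall fun z x _ => ((h.contDiff z).differentiable (by simp) x).hasFDerivAt)
  rw [Metric.mem_ball, dist_eq_norm] at hx
  linarith [norm_le_norm_add_norm_sub' x y]

lemma pd_integral (h : IsDominatedFamily μ F) (i : Fin d) :
    GS.pd i (fun y => ∫ z, F z y ∂μ) = fun y => ∫ z, GS.pd i (F z) y ∂μ := by
  funext y
  obtain ⟨b, hb, hle⟩ := h.exists_norm_fderiv_le ‖y‖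
  have hint : Integrable (fun z => fderiv ℝ (F z) y) μ :=
    hb.mono' (h.aestronglyMeasurable_fderiv y) (.of_forall fun z => hle z y le_rfl)
  rw [GS.pd, (h.hasFDerivAt_integral y).fderiv, ContinuousLinearMap.integral_apply hint]
  rfl

lemma contDiff_integral (h : IsDominatedFamily μ F) : ContDiff ℝ ∞ fun y => ∫ z, F z y ∂μ := by
  refine contDiff_infty.2 fun n => ?_
  induction n generalizing F with
  | zero =>
    exact contDiff_zero.2 (continuous_iff_continuousAt.2 fun y =>
      (h.hasFDerivAt_integral y).continuousAt)
  | succ n ih =>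
    rw [Nat.cast_succ, contDiff_succ_iff_fderiv]
    refine ⟨fun y => (h.hasFDerivAt_integral y).differentiableAt, by simp, ?_⟩
    rw [funext (fderiv_eq_sum_pd _)]
    refine ContDiff.sum fun i _ => contDiff_const.smulRight ?_
    rw [h.pd_integral i]
    exact ih (h.pd i)

lemma pderiv_integral (h : IsDominatedFamily μ F) (β : Fin d → ℕ) :
    pderiv β (fun y => ∫ z, F z y ∂μ) = fun y => ∫ z, pderiv β (F z) y ∂μ := by
  induction β using multiIndex_induction generalizing F with
  | zero => simp only [pderiv_zero]
  | add_single β i ih =>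
    rw [← pderiv_pd β i h.contDiff_integral, h.pd_integral i, ih (h.pd i)]
    simp only [pderiv_pd β i (h.contDiff _)]

end IsDominatedFamily

/-! ### Factorization of ultradistributions through a Banach space -/

open scoped BoundedContinuousFunction in
lemma continuous_of_norm_apply_le_mul {Z X E : Type*} [TopologicalSpace Z] [TopologicalSpace X]
    [NormedAddCommGroup E] {F : Z → X →ᵇ E} (hF : Continuous fun p : Z × X => F p.1 p.2)
    {A : Z → ℝ} (hA : Continuous A) {w : X → ℝ}
    (hw : Filter.Tendsto w (Filter.cocompact X) (nhds 0)) (hle : ∀ z x, ‖F z x‖ ≤ A z * w x) :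
    Continuous F := by
  refine continuous_iff_continuousAt.2 fun z₀ => Metric.tendsto_nhds.2 fun ε hε => ?_
  have htail : Filter.Tendsto (fun p : Z × X => A p.1 * w p.2)
      (nhds z₀ ×ˢ Filter.cocompact X) (nhds 0) := by
    simpa only [mul_zero] using! ((hA.tendsto z₀).comp Filter.tendsto_fst).mul
      (hw.comp Filter.tendsto_snd)
  obtain ⟨P, hP, Q, hQ, hPQ⟩ := Filter.eventually_prod_iff.1
    (htail.eventually_lt_const (show 0 < ε / 4 by positivity))
  obtain ⟨K, hK, hKQ⟩ := Filter.mem_cocompact.1 hQ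
  obtain ⟨N, hN, hNK⟩ := hK.mem_uniformity_of_prod (f := fun z x => F z x) (s := Set.univ)
    hF.continuousOn (Set.mem_univ z₀) (Metric.dist_mem_uniformity (half_pos hε))
  rw [nhdsWithin_univ] at hN
  filter_upwards [hP, hN] with z hPz hNz
  refine lt_of_le_of_lt ((BoundedContinuousFunction.dist_le (half_pos hε).le).2 fun x => ?_)
    (half_lt_self hε)
  by_cases hx : x ∈ K
  · exact (hNK z hNz x hx).le
  · refine (dist_le_norm_add_norm _ _).trans ?_
    linarith [hle z x, hle z₀ x, hPQ hPz (hKQ hx), hPQ hP.self_of_nhds (hKQ hx)]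

lemma exists_continuousLinearMap_apply_eq {V E : Type*} [AddCommGroup V] [Module ℂ V]
    [NormedAddCommGroup E] [NormedSpace ℂ E] (T : V →ₗ[ℂ] E) (v : V →ₗ[ℂ] ℂ) {C : ℝ}
    (hv : ∀ x, ‖v x‖ ≤ C * ‖T x‖) : ∃ L : E →L[ℂ] ℂ, ∀ x, L (T x) = v x := by
  obtain ⟨g, hg⟩ := T.rangeRestrict.exists_rightInverse_of_surjective T.range_rangeRestrict
  have hTg (y : LinearMap.range T) : T (g y) = y := congrArg Subtype.val (LinearMap.congr_fun hg y)
  obtain ⟨L, hL, -⟩ := exists_extension_norm_eq (LinearMap.range T)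
    ((v ∘ₗ g).mkContinuous C fun y => by simpa only [hTg] using! hv (g y))
  refine ⟨L, fun x => (hL ⟨T x, LinearMap.mem_range_self T x⟩).trans (sub_eq_zero.1 ?_)⟩
  refine norm_le_zero_iff.1 ?_
  simpa only [map_sub, hTg, sub_self, norm_zero, mul_zero] using!
    hv (g ⟨T x, LinearMap.mem_range_self T x⟩ - x)

lemma exists_gsSeminorm_le (ht : 0 < t) {h : ℝ} (hh : 0 < h) :
    ∃ a, 0 < a ∧ ∀ {A : ℝ} {φ : GelfandShilov d t s}, HasGSDecay t s A a h φ →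
      ∀ h' : {h : ℝ // 0 < h}, h ≤ h'.1 → gsSeminorm d t s h' φ ≤ A := by
  obtain ⟨a, ha, hmonom⟩ := exists_abs_monom_le (d := d) ht hh
  refine ⟨a, ha, fun {A φ} hφ h' hle => ciSup_le fun ⟨α, β, x⟩ => ?_⟩
  have hA := hφ.nonneg
  refine (div_le_iff₀ (gsDenom_pos t s h'.2 α β)).2 ?_
  calc |monom α x| * ‖pderiv β φ x‖
    _ ≤ Real.exp (a * ‖x‖ ^ (1 / t)) * (h ^ mlen α * (mfact α : ℝ) ^ t) *
          (A * Real.exp (-(a * ‖x‖ ^ (1 / t))) * (h ^ mlen β * (mfact β : ℝ) ^ s)) := by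
      gcongr
      exacts [hmonom α x, hφ.norm_pderiv_le β x]
    _ = A * (h ^ (mlen α + mlen β) * (mfact α : ℝ) ^ t * (mfact β : ℝ) ^ s) := by
      rw [Real.exp_neg, pow_add]
      field_simp
    _ ≤ A * (h'.1 ^ (mlen α + mlen β) * (mfact α : ℝ) ^ t * (mfact β : ℝ) ^ s) := by gcongr

lemma Ultradistribution.exists_norm_le (ht : 0 < t) (u : Ultradistribution d t s) :
    ∃ a k C : ℝ, 0 < a ∧ 0 < k ∧ 0 ≤ C ∧ ∀ {φ : GelfandShilov d t s} {A : ℝ},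
      HasGSDecay t s A a k φ → ‖u φ‖ ≤ C * A := by
  obtain ⟨S, C, -, hle⟩ := Seminorm.bound_of_continuous withSeminorms_gs
    ((normSeminorm ℂ ℂ).comp u.toLinearMap) (continuous_norm.comp u.continuous)
  obtain ⟨k, hk⟩ := Finset.exists_le (α := {h : ℝ // 0 < h}ᵒᵈ) S
  obtain ⟨a, ha, hgs⟩ := exists_gsSeminorm_le (d := d) (s := s) ht k.2
  refine ⟨a, k.1, C, ha, k.2, C.2, fun hφ => (hle _).trans ?_⟩
  exact mul_le_mul_of_nonneg_left
    (Seminorm.finset_sup_apply_le hφ.nonneg fun h' hh' => hgs hφ h' (hk h' hh')) C.2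

/-- The weight `e^{a |y|^{1/t}} / (k^{|β|} β!^s)` by which the derivatives `∂^β f(y)` are
multiplied in the norm measuring `HasGSDecay t s · a k f`. -/
def derivWeight (t s a k : ℝ) (p : (Fin d → ℕ) × Rd d) : ℝ :=
  Real.exp (a * ‖p.2‖ ^ (1 / t)) / (k ^ mlen p.1 * (mfact p.1 : ℝ) ^ s)

lemma derivWeight_pos {a k : ℝ} (hk : 0 < k) (p : (Fin d → ℕ) × Rd d) :
    0 < derivWeight t s a k p := by
  have := mfact_pos p.1
  unfold derivWeight
  positivity

lemma derivWeight_mul_le_iff {a k : ℝ} (hk : 0 < k) (p : (Fin d → ℕ) × Rd d) {A x : ℝ} :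
    derivWeight t s a k p * x ≤ A ↔
      x ≤ A * Real.exp (-(a * ‖p.2‖ ^ (1 / t))) * (k ^ mlen p.1 * (mfact p.1 : ℝ) ^ s) := by
  have := mfact_pos p.1
  rw [derivWeight, div_mul_eq_mul_div, div_le_iff₀ (by positivity), Real.exp_neg, mul_right_comm,
    ← div_eq_mul_inv, le_div_iff₀ (Real.exp_pos _), mul_comm x]

lemma continuous_derivWeight (ht : 0 < t) (a k : ℝ) :
    Continuous (derivWeight t s a k : (Fin d → ℕ) × Rd d → ℝ) := by
  have hexp : Continuous fun y : Rd d => Real.exp (a * ‖y‖ ^ (1 / t)) :=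
    Real.continuous_exp.comp (continuous_const.mul
      (continuous_norm.rpow_const fun _ => .inr (one_div_pos.2 ht).le))
  exact continuous_prod_of_discrete_left.2 fun β =>
    hexp.div_const (k ^ mlen β * (mfact β : ℝ) ^ s)

/-- The linear embedding `φ ↦ (derivWeight (β, y) ∂^β φ(y))_{β, y}` of `Σ_t^s(ℝ^d)` into a Banach
space of bounded continuous functions, through which every ultradistribution factors for suitable
`a` and `k`. -/
def weightedDerivs (ht : 0 < t) {a k : ℝ} (ha : 0 < a) (hk : 0 < k) :
    GelfandShilov d t s →ₗ[ℂ] BoundedContinuousFunction ((Fin d → ℕ) × Rd d) ℂ where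
  toFun φ := .ofNormedAddCommGroup (fun p => derivWeight t s a k p * pderiv p.1 φ p.2)
    ((Complex.continuous_ofReal.comp (continuous_derivWeight ht a k)).mul
      (continuous_prod_of_discrete_left.2 fun β => (contDiff_pderiv φ.2.1 β).continuous))
    (φ.exists_hasGSDecay ht ha hk).choose fun p => by
      rw [norm_mul, Complex.norm_of_nonneg (derivWeight_pos hk p).le,
        derivWeight_mul_le_iff hk]
      exact (φ.exists_hasGSDecay ht ha hk).choose_spec.norm_pderiv_le p.1 p.2
  map_add' φ χ := by
    ext p
    exact (congrArg _ (congrFun (pderiv_add φ.2.1 χ.2.1 p.1) p.2)).trans (mul_add _ _ _)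
  map_smul' c φ := by
    ext p
    exact (congrArg _ (congrFun (pderiv_smul c φ.2.1 p.1) p.2)).trans (mul_left_comm _ _ _)

section weightedDerivs

variable (ht : 0 < t) {a k : ℝ} (ha : 0 < a) (hk : 0 < k) (φ : GelfandShilov d t s)

lemma weightedDerivs_apply (p : (Fin d → ℕ) × Rd d) :
    weightedDerivs ht ha hk φ p = derivWeight t s a k p * pderiv p.1 φ p.2 := rfl

lemma norm_weightedDerivs_apply (p : (Fin d → ℕ) × Rd d) :
    ‖weightedDerivs ht ha hk φ p‖ = derivWeight t s a k p * ‖pderiv p.1 φ p.2‖ := by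
  rw [weightedDerivs_apply, norm_mul, Complex.norm_of_nonneg (derivWeight_pos hk p).le]

lemma hasGSDecay_norm_weightedDerivs : HasGSDecay t s ‖weightedDerivs ht ha hk φ‖ a k φ where
  contDiff := φ.2.1
  norm_pderiv_le β y := by
    rw [← derivWeight_mul_le_iff hk (β, y), ← norm_weightedDerivs_apply ht ha hk φ (β, y)]
    exact (weightedDerivs ht ha hk φ).norm_coe_le_norm (β, y)

variable {φ}

lemma norm_weightedDerivs_le {A : ℝ} (hφ : HasGSDecay t s A a k φ) :
    ‖weightedDerivs ht ha hk φ‖ ≤ A :=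
  (BoundedContinuousFunction.norm_le hφ.nonneg).2 fun p => by
    rw [norm_weightedDerivs_apply, derivWeight_mul_le_iff hk]
    exact hφ.norm_pderiv_le p.1 p.2

lemma norm_weightedDerivs_apply_le {A : ℝ} (hφ : HasGSDecay t s A (a + 1) (k / 2) φ)
    (p : (Fin d → ℕ) × Rd d) : ‖weightedDerivs ht ha hk φ p‖ ≤
      A * ((1 / 2) ^ mlen p.1 * Real.exp (-‖p.2‖ ^ (1 / t))) := by
  rw [norm_weightedDerivs_apply, derivWeight_mul_le_iff hk]
  refine (hφ.norm_pderiv_le p.1 p.2).trans_eq ?_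
  rw [add_mul, one_mul, neg_add, Real.exp_add, div_eq_mul_one_div k, mul_pow]
  ring

end weightedDerivs

lemma tendsto_mlen_cofinite : Filter.Tendsto (mlen : (Fin d → ℕ) → ℕ) Filter.cofinite
    Filter.atTop := by
  refine Filter.tendsto_atTop.2 fun n =>
    (Set.finite_Iic fun _ : Fin d => n).subset fun β (hβ : ¬n ≤ mlen β) i => ?_
  exact (Finset.single_le_sum (fun _ _ => Nat.zero_le _) (Finset.mem_univ i)).trans
    (not_le.1 hβ).le

lemma tendsto_half_pow_mlen_mul_exp_cocompact (ht : 0 < t) :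
    Filter.Tendsto (fun p : (Fin d → ℕ) × Rd d =>
      (1 / 2 : ℝ) ^ mlen p.1 * Real.exp (-‖p.2‖ ^ (1 / t))) (Filter.cocompact _) (nhds 0) := by
  refine tendsto_mul_cocompact_nhds_zero (f := fun β => (1 / 2 : ℝ) ^ mlen β)
    continuous_of_discreteTopology (Real.continuous_exp.comp (continuous_norm.rpow_const
      fun _ => .inr (one_div_pos.2 ht).le).neg) ?_ ?_
  · rw [Filter.cocompact_eq_cofinite]
    exact (tendsto_pow_atTop_nhds_zero_of_lt_one (by norm_num) (by norm_num)).comp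
      tendsto_mlen_cofinite
  · exact Real.tendsto_exp_neg_atTop_nhds_zero.comp
      ((tendsto_rpow_atTop (one_div_pos.2 ht)).comp (tendsto_norm_cocompact_atTop (E := Rd d)))

lemma continuous_weightedDerivs_tfShift (ht : 0 < t) (hs : 0 < s) {a k : ℝ} (ha : 0 < a)
    (hk : 0 < k) (ψ : GelfandShilov d t s) :
    Continuous fun z : Rd d × Rd d => weightedDerivs ht ha hk (tfShift ht hs z.1 z.2 ψ) := by
  obtain ⟨C, r, -, -, hatom⟩ := ψ.exists_hasGSDecay_gaborAtom ht hs
    (a := a + 1) (by positivity) (half_pos hk)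
  refine continuous_of_norm_apply_le_mul ?_
    (A := fun z => C * Real.exp (r * phaseWeight t s z))
    (continuous_const.mul (Real.continuous_exp.comp
      (continuous_const.mul (continuous_phaseWeight ht hs))))
    (tendsto_half_pow_mlen_mul_exp_cocompact ht)
    fun z => norm_weightedDerivs_apply_le ht ha hk (hatom z)
  have hderiv : Continuous fun q : (Fin d → ℕ) × (Rd d × Rd d) × Rd d =>
      pderiv q.1 (gaborAtom ψ q.2.1) q.2.2 :=
    continuous_prod_of_discrete_left.2 fun β =>
      (contDiff_pderiv_uncurry (contDiff_gaborAtom_uncurry ψ.2.1) β).continuous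
  exact (Complex.continuous_ofReal.comp ((continuous_derivWeight ht a k).comp continuous_snd)).mul
    (hderiv.comp (continuous_snd.fst.prodMk (continuous_fst.prodMk continuous_snd.snd)))

/-- The unnormalised short-time Fourier transform `z = (x, ξ) ↦ (u, M_ξ T_x ψ)`. -/
def Ultradistribution.gabor (ht : 0 < t) (hs : 0 < s) (ψ : GelfandShilov d t s)
    (u : Ultradistribution d t s) (z : Rd d × Rd d) : ℂ := u (tfShift ht hs z.1 z.2 ψ)

lemma Ultradistribution.exists_factorization (ht : 0 < t) (u : Ultradistribution d t s) :
    ∃ (a k : ℝ) (ha : 0 < a) (hk : 0 < k)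
      (L : BoundedContinuousFunction ((Fin d → ℕ) × Rd d) ℂ →L[ℂ] ℂ),
      ∀ φ, L (weightedDerivs ht ha hk φ) = starRingEnd ℂ (u φ) := by
  obtain ⟨a, k, C, ha, hk, -, hu⟩ := u.exists_norm_le ht
  let v : GelfandShilov d t s →ₗ[ℂ] ℂ :=
    { toFun φ := starRingEnd ℂ (u φ)
      map_add' φ χ := by rw [map_add, map_add]
      map_smul' c φ := by
        rw [map_smulₛₗ, smul_eq_mul, map_mul, RingHom.id_apply, Complex.conj_conj, smul_eq_mul] }
  obtain ⟨L, hL⟩ := exists_continuousLinearMap_apply_eq (weightedDerivs ht ha hk) v fun φ =>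
    (RCLike.norm_conj (u φ)).trans_le (hu (hasGSDecay_norm_weightedDerivs ht ha hk φ))
  exact ⟨a, k, ha, hk, L, hL⟩

lemma Ultradistribution.continuous_gabor (ht : 0 < t) (hs : 0 < s) (ψ : GelfandShilov d t s)
    (u : Ultradistribution d t s) : Continuous (u.gabor ht hs ψ) := by
  obtain ⟨a, k, ha, hk, L, hL⟩ := u.exists_factorization ht
  have hconj : Continuous fun z => starRingEnd ℂ (u.gabor ht hs ψ z) := by
    simp only [gabor, ← hL]
    exact L.continuous.comp (continuous_weightedDerivs_tfShift ht hs ha hk ψ)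
  simpa only [Function.comp_def, Complex.conj_conj] using Complex.continuous_conj.comp hconj

lemma Ultradistribution.exists_norm_gabor_le (ht : 0 < t) (hs : 0 < s) (ψ : GelfandShilov d t s)
    (u : Ultradistribution d t s) : ∃ C r : ℝ, 0 ≤ C ∧ 0 ≤ r ∧
      ∀ z, ‖u.gabor ht hs ψ z‖ ≤ C * Real.exp (r * phaseWeight t s z) := by
  obtain ⟨a, k, B, ha, hk, hB, hu⟩ := u.exists_norm_le ht
  obtain ⟨C, r, hC, hr, hatom⟩ := ψ.exists_hasGSDecay_gaborAtom ht hs ha hk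
  refine ⟨B * C, r, by positivity, hr, fun z => (hu (hatom z)).trans_eq (mul_assoc _ _ _).symm⟩

lemma GelfandShilov.exists_hasGSDecay_gabor_smul_gaborAtom (ht : 0 < t) (hs : 0 < s)
    (ψ φ : GelfandShilov d t s) {a b k : ℝ} (ha : 0 < a) (hb : 0 < b) (hk : 0 < k) :
    ∃ C : ℝ, ∀ z, HasGSDecay t s (C * Real.exp (-(b * phaseWeight t s z))) a k
        (gabor ψ φ z • gaborAtom ψ z) := by
  obtain ⟨C, r, hC, hr, hatom⟩ := ψ.exists_hasGSDecay_gaborAtom ht hs ha hk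
  obtain ⟨B, hB, hle⟩ := ψ.exists_norm_gabor_le ht hs φ (a := r + b) (by positivity)
  refine ⟨B * C, fun z => ⟨contDiff_const.smul (hatom z).contDiff, fun β y => ?_⟩⟩
  rw [pderiv_smul _ (hatom z).contDiff, Pi.smul_apply, norm_smul]
  refine (mul_le_mul (hle z) ((hatom z).norm_pderiv_le β y) (norm_nonneg _)
    (by positivity)).trans_eq ?_
  rw [add_mul, neg_add, Real.exp_add, Real.exp_neg (r * _)]
  field_simp

lemma isDominatedFamily_smul_gaborAtom {ψ : Rd d → ℂ} (hψ : ContDiff ℝ ∞ ψ)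
    {G : Rd d × Rd d → ℂ} (hG : AEStronglyMeasurable G volume)
    (hbound : ∀ (β : Fin d → ℕ) (ρ : ℝ), ∃ b : Rd d × Rd d → ℝ, Integrable b ∧
      ∀ z y, ‖y‖ ≤ ρ → ‖pderiv β (G z • gaborAtom ψ z) y‖ ≤ b z) :
    IsDominatedFamily volume fun z => G z • gaborAtom ψ z where
  contDiff z := contDiff_const.smul (contDiff_gaborAtom hψ z)
  aestronglyMeasurable β y := by
    simp only [pderiv_smul _ (contDiff_gaborAtom hψ _)]
    exact hG.smul ((contDiff_pderiv_uncurry (contDiff_gaborAtom_uncurry hψ) β).continuous.comp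
      (continuous_id.prodMk continuous_const)).aestronglyMeasurable
  exists_bound := hbound

lemma GelfandShilov.isDominatedFamily_gabor_smul_gaborAtom (ht : 0 < t) (hs : 0 < s)
    (ψ φ : GelfandShilov d t s) :
    IsDominatedFamily volume fun z => gabor ψ φ z • gaborAtom ψ z := by
  obtain ⟨C, hC⟩ := ψ.exists_hasGSDecay_gabor_smul_gaborAtom ht hs φ one_pos one_pos one_pos
  refine isDominatedFamily_smul_gaborAtom ψ.2.1
    (stronglyMeasurable_gabor ψ.2.1 φ.2.1.continuous).aestronglyMeasurable fun β ρ => ?_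
  refine ⟨_, ((integrable_exp_neg_mul_phaseWeight ht hs one_pos).const_mul C).mul_const
    (1 ^ mlen β * (mfact β : ℝ) ^ s), fun z y _ => ((hC z).norm_pderiv_le β y).trans ?_⟩
  refine mul_le_mul_of_nonneg_right (mul_le_of_le_one_right (hC z).nonneg ?_) (by positivity)
  exact Real.exp_le_one_iff.2 (neg_nonpos.2 (by positivity))

lemma GelfandShilov.gaborConst_mul_pderiv (ht : 0 < t) (hs : 0 < s) (ψ φ : GelfandShilov d t s)
    (β : Fin d → ℕ) (y : Rd d) :
    (gaborConst ψ : ℂ) * pderiv β φ y = ∫ z, gabor ψ φ z * pderiv β (gaborAtom ψ z) y := by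
  have hinv : (gaborConst ψ : ℂ) • (φ : Rd d → ℂ) =
      fun y => ∫ z, (gabor ψ φ z • gaborAtom ψ z) y :=
    funext fun y => (ψ.integral_gabor_mul_gaborAtom ht hs φ y).symm
  have hderiv := congrFun (congrArg (pderiv β) hinv) y
  rw [(ψ.isDominatedFamily_gabor_smul_gaborAtom ht hs φ).pderiv_integral, pderiv_smul _ φ.2.1]
    at hderiv
  simpa only [pderiv_smul _ (contDiff_gaborAtom ψ.2.1 _)] using! hderiv

lemma integrable_gabor_smul_weightedDerivs (ht : 0 < t) (hs : 0 < s) {a k : ℝ} (ha : 0 < a)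
    (hk : 0 < k) (ψ φ : GelfandShilov d t s) :
    Integrable fun z : Rd d × Rd d =>
      gabor ψ φ z • weightedDerivs ht ha hk (tfShift ht hs z.1 z.2 ψ) := by
  obtain ⟨C, hC⟩ := ψ.exists_hasGSDecay_gabor_smul_gaborAtom ht hs φ ha one_pos hk
  refine ((integrable_exp_neg_mul_phaseWeight ht hs one_pos).const_mul C).mono'
    ((stronglyMeasurable_gabor ψ.2.1 φ.2.1.continuous).aestronglyMeasurable.smul
      (continuous_weightedDerivs_tfShift ht hs ha hk ψ).aestronglyMeasurable)
    (.of_forall fun z => ?_)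
  rw [← map_smul]
  exact norm_weightedDerivs_le ht ha hk (hC z)

lemma integral_gabor_smul_weightedDerivs (ht : 0 < t) (hs : 0 < s) {a k : ℝ} (ha : 0 < a)
    (hk : 0 < k) (ψ φ : GelfandShilov d t s) :
    ∫ z : Rd d × Rd d, gabor ψ φ z • weightedDerivs ht ha hk (tfShift ht hs z.1 z.2 ψ) =
      (gaborConst ψ : ℂ) • weightedDerivs ht ha hk φ := by
  ext p
  have heval := (BoundedContinuousFunction.evalCLM ℂ p).integral_comp_comm
    (integrable_gabor_smul_weightedDerivs ht hs ha hk ψ φ)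
  calc _ = ∫ z, gabor ψ φ z * (derivWeight t s a k p * pderiv p.1 (gaborAtom ψ z) p.2) :=
        heval.symm
    _ = derivWeight t s a k p * (gaborConst ψ * pderiv p.1 φ p.2) := by
      rw [ψ.gaborConst_mul_pderiv ht hs φ, ← integral_const_mul]
      simp only [mul_left_comm]
    _ = _ := mul_left_comm _ _ _

lemma Ultradistribution.gaborConst_mul_apply (ht : 0 < t) (hs : 0 < s)
    (ψ φ : GelfandShilov d t s) (u : Ultradistribution d t s) :
    (gaborConst ψ : ℂ) * u φ = ∫ z, u.gabor ht hs ψ z * starRingEnd ℂ (GS.gabor ψ φ z) := by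
  obtain ⟨a, k, ha, hk, L, hL⟩ := u.exists_factorization ht
  have hinv := congrArg L (integral_gabor_smul_weightedDerivs ht hs ha hk ψ φ)
  rw [← L.integral_comp_comm (integrable_gabor_smul_weightedDerivs ht hs ha hk ψ φ)] at hinv
  simp only [map_smul, hL, smul_eq_mul] at hinv
  have hconj := congrArg (starRingEnd ℂ) hinv
  rw [← integral_conj] at hconj
  simp only [map_mul, Complex.conj_conj, Complex.conj_ofReal] at hconj
  simpa only [mul_comm, gabor] using hconj.symm

/-! ### The wave front condition -/

/-- Superexponential decay of the Gabor transform of `u` along the curves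
`λ ↦ (λ^t x, λ^s ξ)`, uniformly for `(x, ξ) ∈ S`. A nonzero point lies outside the wave front set
iff this holds on a neighbourhood of it. -/
def Ultradistribution.DecaysOn (ht : 0 < t) (hs : 0 < s) (ψ : GelfandShilov d t s)
    (u : Ultradistribution d t s) (S : Set (Rd d × Rd d)) : Prop :=
  ∀ r : ℝ, 0 < r → ∃ C : ℝ, ∀ lam : ℝ, 0 < lam → ∀ z ∈ S,
    ‖u.gabor ht hs ψ (lam ^ t • z.1, lam ^ s • z.2)‖ ≤ C * Real.exp (-(r * lam))

section waveFrontSet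

variable {ht : 0 < t} {hs : 0 < s} {ψ : GelfandShilov d t s} {u : Ultradistribution d t s}

lemma Ultradistribution.DecaysOn.mono {S S' : Set (Rd d × Rd d)} (h : u.DecaysOn ht hs ψ S')
    (hS : S ⊆ S') : u.DecaysOn ht hs ψ S := fun r hr =>
  (h r hr).imp fun _ hC lam hlam z hz => hC lam hlam z (hS hz)

lemma Ultradistribution.DecaysOn.union {S S' : Set (Rd d × Rd d)} (h : u.DecaysOn ht hs ψ S)
    (h' : u.DecaysOn ht hs ψ S') : u.DecaysOn ht hs ψ (S ∪ S') := fun r hr => by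
  obtain ⟨C, hC⟩ := h r hr
  obtain ⟨C', hC'⟩ := h' r hr
  refine ⟨max C C', fun lam hlam z hz => ?_⟩
  rcases hz with hz | hz
  · exact (hC lam hlam z hz).trans (by gcongr; exact le_max_left C C')
  · exact (hC' lam hlam z hz).trans (by gcongr; exact le_max_right C C')

lemma exists_isOpen_decaysOn_of_notMem_waveFrontSet {z₀ : Rd d × Rd d} (hz₀ : z₀ ≠ 0)
    (h : z₀ ∉ waveFrontSet ht hs ψ u) : ∃ U, IsOpen U ∧ z₀ ∈ U ∧ u.DecaysOn ht hs ψ U := by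
  simp only [waveFrontSet, Set.mem_ofPred_eq, not_and, not_not] at h
  obtain ⟨U, hU, -, hmem, hdecay⟩ := h hz₀
  refine ⟨U, hU, hmem, fun r hr => ?_⟩
  obtain ⟨C, hC⟩ := hdecay r hr
  refine ⟨C / (2 * Real.pi) ^ (-(d : ℝ) / 2), fun lam hlam z hz => ?_⟩
  have hstft := hC lam hlam z hz
  rw [stft, norm_mul, Complex.norm_of_nonneg (by positivity), mul_left_comm,
    ← le_div_iff₀' (by positivity)] at hstft
  rwa [Real.exp_neg, ← div_eq_mul_inv, le_div_iff₀' (Real.exp_pos _)]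

lemma exists_isOpen_superset_decaysOn {K : Set (Rd d × Rd d)} (hK : IsCompact K) (h0 : 0 ∉ K)
    (hWF : Disjoint (waveFrontSet ht hs ψ u) K) :
    ∃ V, IsOpen V ∧ K ⊆ V ∧ u.DecaysOn ht hs ψ V := by
  refine hK.induction_on (p := fun S => ∃ V, IsOpen V ∧ S ⊆ V ∧ u.DecaysOn ht hs ψ V)
    ⟨∅, isOpen_empty, subset_rfl, fun r _ => ⟨0, by simp⟩⟩ ?_ ?_ fun z hz => ?_
  · exact fun S S' hSS' ⟨V, hV, hSV, hdecay⟩ => ⟨V, hV, hSS'.trans hSV, hdecay⟩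
  · exact fun S S' ⟨V, hV, hSV, hdecay⟩ ⟨V', hV', hSV', hdecay'⟩ =>
      ⟨V ∪ V', hV.union hV', Set.union_subset_union hSV hSV', hdecay.union hdecay'⟩
  · obtain ⟨U, hU, hzU, hdecay⟩ := exists_isOpen_decaysOn_of_notMem_waveFrontSet
      (ne_of_mem_of_not_mem hz h0) (hWF.notMem_of_mem_right hz)
    exact ⟨U, mem_nhdsWithin_of_mem_nhds (hU.mem_nhds hzU), U, hU, subset_rfl, hdecay⟩

lemma exists_decaysOn_ball_prod_sphere (hWF : waveFrontSet ht hs ψ u ∩ ({0} ×ˢ {0}ᶜ) = ∅) :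
    ∃ ε : ℝ, 0 < ε ∧ u.DecaysOn ht hs ψ (Metric.ball 0 ε ×ˢ Metric.sphere 0 1) := by
  set K : Set (Rd d × Rd d) := {0} ×ˢ Metric.sphere 0 1
  have hK : IsCompact K := isCompact_singleton.prod (isCompact_sphere 0 1)
  have hK0 : K ⊆ {0} ×ˢ {0}ᶜ := Set.prod_mono subset_rfl fun ξ hξ =>
    norm_ne_zero_iff.1 (by simp [mem_sphere_zero_iff_norm.1 hξ])
  obtain ⟨V, hV, hKV, hdecay⟩ := exists_isOpen_superset_decaysOn hK
    (fun h => (hK0 h).2 rfl) ((Set.disjoint_iff_inter_eq_empty.2 hWF).mono_right hK0)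
  obtain ⟨ε, hε, hthick⟩ := hK.exists_thickening_subset_open hV hKV
  refine ⟨ε, hε, hdecay.mono fun z hz => hthick (Metric.mem_thickening_iff.2 ?_)⟩
  refine ⟨(0, z.2), ⟨rfl, hz.2⟩, ?_⟩
  simpa [Prod.dist_eq, hε] using hz.1

lemma Ultradistribution.DecaysOn.exists_norm_gabor_le_of_norm_lt {ε : ℝ}
    (h : u.DecaysOn ht hs ψ (Metric.ball 0 ε ×ˢ Metric.sphere 0 1)) {r : ℝ} (hr : 0 < r) :
    ∃ C : ℝ, ∀ z : Rd d × Rd d, ‖z.1‖ < ε * (‖z.2‖ ^ (1 / s)) ^ t →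
      ‖u.gabor ht hs ψ z‖ ≤ C * Real.exp (-(r * ‖z.2‖ ^ (1 / s))) := by
  obtain ⟨C, hC⟩ := h r hr
  refine ⟨C, fun z hz => ?_⟩
  have hξ : 0 < ‖z.2‖ := (norm_nonneg z.2).lt_of_ne fun h0 => by
    rw [← h0, Real.zero_rpow (one_div_pos.2 hs).ne', Real.zero_rpow ht.ne', mul_zero] at hz
    exact hz.not_ge (norm_nonneg z.1)
  have hlam : (‖z.2‖ ^ (1 / s)) ^ s = ‖z.2‖ := by
    rw [← Real.rpow_mul hξ.le, one_div_mul_cancel hs.ne', Real.rpow_one]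
  have hlamt : 0 < (‖z.2‖ ^ (1 / s)) ^ t := by positivity
  have hball : ((‖z.2‖ ^ (1 / s)) ^ t)⁻¹ • z.1 ∈ Metric.ball 0 ε := by
    rw [mem_ball_zero_iff, norm_smul, norm_inv, Real.norm_of_nonneg hlamt.le, inv_mul_lt_iff₀ hlamt,
      mul_comm]
    exact hz
  have hsphere : ‖z.2‖⁻¹ • z.2 ∈ Metric.sphere 0 1 := by
    rw [mem_sphere_zero_iff_norm, norm_smul, norm_inv, norm_norm, inv_mul_cancel₀ hξ.ne']
  have := hC (‖z.2‖ ^ (1 / s)) (by positivity) (_, _) ⟨hball, hsphere⟩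
  rwa [hlam, smul_inv_smul₀ hlamt.ne', smul_inv_smul₀ hξ.ne'] at this

end waveFrontSet

lemma le_mul_rpow_one_div_of_mul_rpow_le {ε lam x : ℝ} (ht : 0 < t) (hε : 0 < ε) (hlam : 0 ≤ lam)
    (h : ε * lam ^ t ≤ x) : lam ≤ (1 / ε) ^ (1 / t) * x ^ (1 / t) := by
  have hx : 0 ≤ x := le_trans (by positivity) h
  rw [← Real.mul_rpow (by positivity) hx, one_div t,
    Real.le_rpow_inv_iff_of_pos hlam (by positivity) ht, one_div, le_inv_mul_iff₀ hε]
  exact h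

/-- Exponential decay of every order in the frequency variable, at the expense of exponential
growth in the space variable. -/
def HasFrequencyDecay (t s : ℝ) (G : Rd d × Rd d → ℂ) : Prop :=
  ∀ r : ℝ, 0 < r → ∃ C R : ℝ, 0 ≤ C ∧ 0 ≤ R ∧ ∀ z, ‖G z‖ ≤
    C * (Real.exp (-(r * ‖z.2‖ ^ (1 / s))) * Real.exp (R * ‖z.1‖ ^ (1 / t)))

lemma hasFrequencyDecay_gabor {ht : 0 < t} {hs : 0 < s} {ψ : GelfandShilov d t s}
    {u : Ultradistribution d t s} (hWF : waveFrontSet ht hs ψ u ∩ ({0} ×ˢ {0}ᶜ) = ∅) :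
    HasFrequencyDecay t s (u.gabor ht hs ψ) := by
  intro r hr
  obtain ⟨C₀, r₀, hC₀, hr₀, hgrow⟩ := u.exists_norm_gabor_le ht hs ψ
  obtain ⟨ε, hε, hdecay⟩ := exists_decaysOn_ball_prod_sphere hWF
  obtain ⟨C₁, hC₁⟩ := hdecay.exists_norm_gabor_le_of_norm_lt hr
  set K : ℝ := (1 / ε) ^ (1 / t)
  have hR : 0 ≤ r₀ + (r₀ + r) * K := by positivity
  refine ⟨max C₀ C₁, r₀ + (r₀ + r) * K, hC₀.trans (le_max_left _ _), hR, fun z => ?_⟩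
  rw [← Real.exp_add]
  rcases lt_or_ge ‖z.1‖ (ε * (‖z.2‖ ^ (1 / s)) ^ t) with hz | hz
  · refine (hC₁ z hz).trans ?_
    gcongr
    · exact le_max_right C₀ C₁
    · exact le_add_of_nonneg_right (by positivity)
  · refine (hgrow z).trans ?_
    gcongr
    · exact le_max_left C₀ C₁
    · have hlam := mul_le_mul_of_nonneg_left
        (le_mul_rpow_one_div_of_mul_rpow_le ht hε (by positivity) hz) (add_nonneg hr₀ hr.le)
      rw [phaseWeight]
      linarith

/-! ### Synthesis -/

/-- The adjoint of the Gabor transform: the superposition of the Gabor atoms of `ψ` with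
coefficients `G`. -/
def gaborSynthesis (ψ : Rd d → ℂ) (G : Rd d × Rd d → ℂ) (y : Rd d) : ℂ :=
  ∫ z, (G z • gaborAtom ψ z) y

lemma HasFrequencyDecay.exists_norm_pderiv_smul_gaborAtom_le (ht : 0 < t) (hs : 0 < s)
    (ψ : GelfandShilov d t s) {G : Rd d × Rd d → ℂ} (hG : HasFrequencyDecay t s G) :
    ∃ C a : ℝ, 0 ≤ C ∧ 0 < a ∧ ∀ β z y, ‖pderiv β (G z • gaborAtom ψ z) y‖ ≤
      C * (2 ^ mlen β * (mfact β : ℝ) ^ s) * Real.exp (a * ‖y‖ ^ (1 / t)) *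
        Real.exp (-(1 * phaseWeight t s z)) := by
  obtain ⟨c, hc, hatom⟩ := exists_norm_pderiv_gaborAtom_le (d := d) (t := t) hs one_pos
  obtain ⟨C, R, hC, hR, hdecay⟩ := hG (c + 1) (by positivity)
  set a : ℝ := (R + 1) * 2 ^ (1 / t)
  have ha : 0 < a := by positivity
  obtain ⟨A, hψ⟩ := ψ.exists_hasGSDecay ht ha one_pos
  have hA := hψ.nonneg
  refine ⟨C * A, a, by positivity, ha, fun β z y => ?_⟩
  have hnorm : (R + 1) * ‖z.1‖ ^ (1 / t) ≤ a * ‖y‖ ^ (1 / t) + a * ‖y - z.1‖ ^ (1 / t) := by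
    rw [← mul_add, mul_assoc, norm_sub_rev y]
    gcongr
    exact norm_rpow_le_two_rpow_mul (one_div_pos.2 ht).le z.1 y
  rw [pderiv_smul _ (contDiff_gaborAtom hψ.contDiff z), Pi.smul_apply, norm_smul]
  calc ‖G z‖ * ‖pderiv β (gaborAtom ψ z) y‖
    _ ≤ C * (Real.exp (-((c + 1) * ‖z.2‖ ^ (1 / s))) * Real.exp (R * ‖z.1‖ ^ (1 / t))) *
          (Real.exp (c * ‖z.2‖ ^ (1 / s)) * (A * Real.exp (-(a * ‖y - z.1‖ ^ (1 / t)))) *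
            ((2 * 1) ^ mlen β * (mfact β : ℝ) ^ s)) := by
      gcongr
      · exact hdecay z
      · exact hatom hψ β z y
    _ = C * A * (2 ^ mlen β * (mfact β : ℝ) ^ s) * Real.exp (-((c + 1) * ‖z.2‖ ^ (1 / s)) +
          R * ‖z.1‖ ^ (1 / t) + c * ‖z.2‖ ^ (1 / s) + -(a * ‖y - z.1‖ ^ (1 / t))) := by
      simp only [Real.exp_add]
      ring
    _ ≤ C * A * (2 ^ mlen β * (mfact β : ℝ) ^ s) *
          Real.exp (a * ‖y‖ ^ (1 / t) + -(1 * phaseWeight t s z)) := by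
      rw [phaseWeight]
      gcongr _ * Real.exp ?_
      linarith
    _ = _ := by rw [Real.exp_add, mul_assoc _ (Real.exp _)]

section synthesis

variable {ψ : GelfandShilov d t s} {G : Rd d × Rd d → ℂ}

lemma HasFrequencyDecay.isDominatedFamily (ht : 0 < t) (hs : 0 < s)
    (hG : HasFrequencyDecay t s G) (hGm : AEStronglyMeasurable G volume) :
    IsDominatedFamily volume fun z => G z • gaborAtom ψ z := by
  obtain ⟨C, a, hC, ha, hle⟩ := hG.exists_norm_pderiv_smul_gaborAtom_le ht hs ψ
  refine isDominatedFamily_smul_gaborAtom ψ.2.1 hGm fun β ρ =>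
    ⟨_, (integrable_exp_neg_mul_phaseWeight ht hs one_pos).const_mul
      (C * (2 ^ mlen β * (mfact β : ℝ) ^ s) * Real.exp (a * ρ ^ (1 / t))), fun z y hy => ?_⟩
  refine (hle β z y).trans ?_
  gcongr

lemma HasFrequencyDecay.exists_norm_pderiv_gaborSynthesis_le (ht : 0 < t) (hs : 0 < s)
    (hG : HasFrequencyDecay t s G) (hGm : AEStronglyMeasurable G volume) :
    ∃ C a : ℝ, 0 ≤ C ∧ 0 < a ∧ ∀ β y, ‖pderiv β (gaborSynthesis ψ G) y‖ ≤
      C * (2 ^ mlen β * (mfact β : ℝ) ^ s) * Real.exp (a * ‖y‖ ^ (1 / t)) := by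
  obtain ⟨C, a, hC, ha, hle⟩ := hG.exists_norm_pderiv_smul_gaborAtom_le ht hs ψ
  have hint := integrable_exp_neg_mul_phaseWeight (d := d) ht hs one_pos
  set K : ℝ := ∫ z : Rd d × Rd d, Real.exp (-(1 * phaseWeight t s z))
  have hK : 0 ≤ K := integral_nonneg fun z => (Real.exp_pos _).le
  refine ⟨C * K, a, by positivity, ha, fun β y => ?_⟩
  have hderiv : pderiv β (gaborSynthesis ψ G) = fun y => ∫ z, pderiv β (G z • gaborAtom ψ z) y :=
    (hG.isDominatedFamily ht hs hGm).pderiv_integral β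
  rw [hderiv]
  refine (norm_integral_le_of_norm_le (hint.const_mul _)
    (.of_forall fun z => hle β z y)).trans_eq ?_
  rw [integral_const_mul]
  ring

lemma HasFrequencyDecay.integrable_synthesis_kernel (ht : 0 < t) (hs : 0 < s)
    (hG : HasFrequencyDecay t s G) (hGm : AEStronglyMeasurable G volume)
    (φ : GelfandShilov d t s) :
    Integrable fun p : Rd d × (Rd d × Rd d) =>
      (G p.2 • gaborAtom ψ p.2) p.1 * starRingEnd ℂ (φ p.1) := by
  obtain ⟨C, a, hC, ha, hle⟩ := hG.exists_norm_pderiv_smul_gaborAtom_le ht hs ψ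
  obtain ⟨B, hφ⟩ := φ.exists_hasGSDecay ht (a := a + 1) (by positivity) one_pos
  have hmeas : AEStronglyMeasurable (fun p : Rd d × (Rd d × Rd d) =>
      (G p.2 • gaborAtom ψ p.2) p.1 * starRingEnd ℂ (φ p.1)) volume :=
    (hGm.comp_snd.mul ((contDiff_gaborAtom_uncurry ψ.2.1).continuous.comp
      continuous_swap).aestronglyMeasurable).mul
      (Complex.continuous_conj.comp (φ.2.1.continuous.comp continuous_fst)).aestronglyMeasurable
  refine (((integrable_exp_neg_mul_norm_rpow one_pos (one_div_pos.2 ht)).const_mul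
    (C * B)).mul_prod (integrable_exp_neg_mul_phaseWeight ht hs one_pos)).mono' hmeas
    (.of_forall fun ⟨y, z⟩ => ?_)
  have hatom := hle 0 z y
  simp only [pderiv_zero, mlen_zero, mfact_zero, pow_zero, Nat.cast_one, Real.one_rpow,
    mul_one] at hatom
  rw [norm_mul, RCLike.norm_conj]
  calc ‖(G z • gaborAtom ψ z) y‖ * ‖φ y‖
    _ ≤ C * Real.exp (a * ‖y‖ ^ (1 / t)) * Real.exp (-(1 * phaseWeight t s z)) *
          (B * Real.exp (-((a + 1) * ‖y‖ ^ (1 / t)))) := by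
      gcongr
      exact hφ.norm_le y
    _ = C * B * (Real.exp (a * ‖y‖ ^ (1 / t)) * Real.exp (-((a + 1) * ‖y‖ ^ (1 / t)))) *
          Real.exp (-(1 * phaseWeight t s z)) := by ring
    _ = _ := by
      rw [← Real.exp_add]
      ring_nf

lemma gaborSynthesis_mul_conj (φ : Rd d → ℂ) (y : Rd d) :
    gaborSynthesis ψ G y * starRingEnd ℂ (φ y) =
      ∫ z, (G z • gaborAtom ψ z) y * starRingEnd ℂ (φ y) :=
  (integral_mul_const _ _).symm

lemma HasFrequencyDecay.integrable_gaborSynthesis_mul_conj (ht : 0 < t) (hs : 0 < s)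
    (hG : HasFrequencyDecay t s G) (hGm : AEStronglyMeasurable G volume)
    (φ : GelfandShilov d t s) :
    Integrable fun y => gaborSynthesis ψ G y * starRingEnd ℂ (φ y) := by
  simp only [gaborSynthesis_mul_conj]
  exact (hG.integrable_synthesis_kernel ht hs hGm φ).integral_prod_left

lemma HasFrequencyDecay.integral_gaborSynthesis_mul_conj (ht : 0 < t) (hs : 0 < s)
    (hG : HasFrequencyDecay t s G) (hGm : AEStronglyMeasurable G volume)
    (φ : GelfandShilov d t s) :
    ∫ y, gaborSynthesis ψ G y * starRingEnd ℂ (φ y) = ∫ z, G z * starRingEnd ℂ (gabor ψ φ z) := by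
  simp only [gaborSynthesis_mul_conj]
  rw [integral_integral_swap (hG.integrable_synthesis_kernel ht hs hGm φ)]
  congr 1
  funext z
  rw [gabor, ← integral_conj, ← integral_const_mul]
  simp only [map_mul, Complex.conj_conj, Pi.smul_apply, smul_eq_mul, mul_assoc, mul_comm]

end synthesis

lemma Ultradistribution.isGivenBy_gaborSynthesis {ht : 0 < t} {hs : 0 < s}
    {ψ : GelfandShilov d t s} (hψ : ψ ≠ 0) {u : Ultradistribution d t s}
    (hu : HasFrequencyDecay t s (u.gabor ht hs ψ)) :
    IsGivenBy u ((gaborConst ψ : ℂ)⁻¹ • gaborSynthesis ψ (u.gabor ht hs ψ)) := by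
  have hmeas := (u.continuous_gabor ht hs ψ).aestronglyMeasurable (μ := volume)
  have hN : (gaborConst ψ : ℂ) ≠ 0 :=
    Complex.ofReal_ne_zero.2 (GelfandShilov.gaborConst_pos ht hψ).ne'
  intro φ
  simp only [Pi.smul_apply, smul_eq_mul, mul_assoc]
  refine ⟨(hu.integrable_gaborSynthesis_mul_conj ht hs hmeas φ).const_mul _, ?_⟩
  rw [integral_const_mul, hu.integral_gaborSynthesis_mul_conj ht hs hmeas φ,
    ← Ultradistribution.gaborConst_mul_apply, inv_mul_cancel_left₀ hN]

lemma mul_pow_le_pow_one_add {A B M : ℝ} (hA : 0 ≤ A) (hB : 0 ≤ B) (hAM : A ≤ M) (hBM : B ≤ M)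
    (n : ℕ) : A * B ^ n ≤ M ^ (1 + n) := by
  rw [pow_add, pow_one]
  gcongr
  exact hA.trans hAM

end GS

end

theorem proposition5p4 (d : ℕ) (t s : ℝ) (ht : 0 < t) (hs : 0 < s) (hst : 1 < s + t)
    (ψ : GS.GelfandShilov d t s) (hψ : ψ ≠ 0) (u : GS.Ultradistribution d t s)
    (hWF : GS.waveFrontSet ht hs ψ u ∩ ({0} ×ˢ {0}ᶜ) = ∅) :
    ∃ f : GS.Rd d → ℂ, ContDiff ℝ ∞ f ∧ GS.IsGivenBy u f ∧
      ∃ C r : ℝ, 0 < C ∧ 0 < r ∧ ∀ (x : GS.Rd d) (α : Fin d → ℕ),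
        ‖GS.pderiv α f x‖ ≤
          C ^ (1 + GS.mlen α) * (GS.mfact α : ℝ) ^ s * Real.exp (r * ‖x‖ ^ (1 / t)) := by
  have hdecay := GS.hasFrequencyDecay_gabor hWF
  have hmeas := (u.continuous_gabor ht hs ψ).aestronglyMeasurable (μ := MeasureTheory.volume)
  have hsmooth : ContDiff ℝ ∞ (GS.gaborSynthesis ψ (u.gabor ht hs ψ)) :=
    (hdecay.isDominatedFamily ht hs hmeas).contDiff_integral
  obtain ⟨C, r, hC, hr, hle⟩ :=
    hdecay.exists_norm_pderiv_gaborSynthesis_le (ψ := ψ) ht hs hmeas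
  set N : ℂ := (GS.gaborConst ψ : ℂ)⁻¹
  refine ⟨N • GS.gaborSynthesis ψ (u.gabor ht hs ψ), contDiff_const.smul hsmooth,
    u.isGivenBy_gaborSynthesis hψ hdecay, max (‖N‖ * C) 2, r, by positivity, hr, fun x α => ?_⟩
  rw [GS.pderiv_smul N hsmooth, Pi.smul_apply, norm_smul]
  calc ‖N‖ * ‖GS.pderiv α (GS.gaborSynthesis ψ (u.gabor ht hs ψ)) x‖
    _ ≤ ‖N‖ * (C * (2 ^ GS.mlen α * (GS.mfact α : ℝ) ^ s) * Real.exp (r * ‖x‖ ^ (1 / t))) := by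
      gcongr
      exact hle α x
    _ = ‖N‖ * C * 2 ^ GS.mlen α * (GS.mfact α : ℝ) ^ s * Real.exp (r * ‖x‖ ^ (1 / t)) := by ring
    _ ≤ _ := by
      gcongr
      exact GS.mul_pow_le_pow_one_add (by positivity) zero_le_two (le_max_left _ _)
        (le_max_right _ _) _
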